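/- Let $n\in\mathbb N$, $0<T<\infty$, and let $b:[0,T]\times\mathbb R^n\to\mathbb R^n$ be a (Lebesgue measurable) vector field. For $\rho_0\in L^1(\mathbb R^n)$, a function $\rho\in L^1(0,T;L^1(\mathbb R^n))$ is called a weak solution of the Cauchy problem $$\partial_t\rho+\operatorname{div}(b\rho)=0\ \text{ in }(0,T)\times\mathbb R^n,\qquad \rho(0,\cdot)=\rho_0\ \text{ in }\mathbb R^n \tag{CP}$$ if for every $\varphi\in C_c^\infty([0,T)\times\mathbb R^n)$ $$\int_0^T\!\!\int_{\mathbb R^n}\big[\partial_t\varphi(t,x)+\langle b(t,x),\nabla\varphi(t,x)\rangle\big]\rho(t,x)\,dx\,dt+\int_{\mathbb R^n}\varphi(0,x)\rho_0(x)\,dx=0 .$$ (1) Suppose that there is a constant $C$ such that for almost every $t\in[0,T]$ and all $x,y\in\mathbb R^n$ $$|b(t,x)|\le C(1+|x|),\qquad |b(t,x)-b(t,y)|\le C\,|x-y|\,\log\Big(e+\frac1{|x-y|}\Big),$$ the right-hand side of the second inequality being $0$ when $x=y$. Then for every $\rho_0\in L^1(\mathbb R^n)$ the problem (CP) has at most one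 weak solution $\rho\in L^1(0,T;L^1(\mathbb R^n))$: any two weak solutions agree as elements of $L^1(\mathbb R^n)$ for almost every $t\in(0,T)$. (2) More generally, suppose that there are a continuous nondecreasing function $G:[0,\infty)\to(0,\infty)$ with $\int_r^\infty\frac{ds}{G(s)}=\infty$ for some $r>0$, a continuous nondecreasing function $\omega:[0,\infty)\to[0,\infty)$ with $\int_0^r\frac{ds}{\omega(s)}=\infty$ for some $r>0$ (where $1/0=\infty$), and constants $C_G,C_\omega$ such that for almost every $t\in(0,T)$ and all $x,y\in\mathbb R^n$ $$|b(t,x)|\le C_G\,G(|x|),\qquad |b(t,x)-b(t,y)|\le C_\omega\,\omega(|x-y|).$$ If $u\in L^1(0,T;L^1(\mathbb R^n))$ is a weak solution of (CP) with initial datum $\rho_0=0$, then $u(t,\cdot)=0$ in $L^1(\mathbb R^n)$ for almost every $t\in(0,T)$. Consequently, for every $\rho_0\in L^1(\mathbb R^n)$ the problem (CP) has at most one weak solution in $L^1(0,T;L^1(\mathbb R^n))$. -/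

import Mathlib

open MeasureTheory Set
open scoped ContDiff

namespace ContinuityEquation

/-- Test functions `φ ∈ C_c^∞([0,T) × ℝⁿ)`, given as (the restriction to `t ≥ 0` of) smooth
compactly supported functions on `ℝ × ℝⁿ` whose support lies in `(-∞,T) × ℝⁿ`.
Such a `φ` need not vanish at `t = 0`. -/
def IsTestFunction {n : ℕ} (T : ℝ) (φ : ℝ × EuclideanSpace ℝ (Fin n) → ℝ) : Prop :=
  ContDiff ℝ ∞ φ ∧ HasCompactSupport φ ∧ tsupport φ ⊆ Iio T ×ˢ univ

/-- `ρ ∈ L¹(0,T; L¹(ℝⁿ))`: a function of `(t,x)` that is (jointly a.e. strongly measurable and)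
integrable over `(0,T) × ℝⁿ`. -/
def MemL1L1 {n : ℕ} (T : ℝ) (ρ : ℝ → EuclideanSpace ℝ (Fin n) → ℝ) : Prop :=
  Integrable (Function.uncurry ρ) ((volume.restrict (Ioo 0 T)).prod volume)

/-- `ρ ∈ L¹(0,T; L¹(ℝⁿ))` is a weak solution of the Cauchy problem
`∂ₜρ + div(b ρ) = 0` in `(0,T) × ℝⁿ`, `ρ(0,·) = ρ₀`. -/
def IsWeakSolution {n : ℕ} (T : ℝ)
    (b : ℝ → EuclideanSpace ℝ (Fin n) → EuclideanSpace ℝ (Fin n))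
    (ρ₀ : EuclideanSpace ℝ (Fin n) → ℝ) (ρ : ℝ → EuclideanSpace ℝ (Fin n) → ℝ) : Prop :=
  MemL1L1 T ρ ∧
    ∀ φ : ℝ × EuclideanSpace ℝ (Fin n) → ℝ, IsTestFunction T φ →
      (∫ t in Ioo 0 T, ∫ x,
          (deriv (fun s => φ (s, x)) t
            + inner ℝ (b t x) (gradient (fun y => φ (t, y)) x)) * ρ t x)
        + ∫ x, φ (0, x) * ρ₀ x = 0

/-- Equality of two elements of `L¹(0,T; L¹(ℝⁿ))`: for a.e. `t ∈ (0,T)` the two time slices agree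
as elements of `L¹(ℝⁿ)`. -/
def EqL1L1 {n : ℕ} (T : ℝ) (ρ₁ ρ₂ : ℝ → EuclideanSpace ℝ (Fin n) → ℝ) : Prop :=
  ∀ᵐ t ∂(volume.restrict (Ioo 0 T)), ρ₁ t =ᵐ[volume] ρ₂ t

/-- A continuous nondecreasing `G : [0,∞) → (0,∞)` with `∫_r^∞ ds / G(s) = ∞` for some `r > 0`
(only the values on `[0,∞)` matter). -/
structure IsGrowthBound (G : ℝ → ℝ) : Prop where
  continuousOn : ContinuousOn G (Ici 0)
  monotoneOn : MonotoneOn G (Ici 0)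
  pos : ∀ s, 0 ≤ s → 0 < G s
  lintegral_eq_top : ∃ r, 0 < r ∧ ∫⁻ s in Ioi r, (ENNReal.ofReal (G s))⁻¹ = ⊤

/-- A continuous nondecreasing `w : [0,∞) → [0,∞)` with `∫_0^r ds / w(s) = ∞` for some `r > 0`
(only the values on `[0,∞)` matter; `1/w(s) = ∞` where `w(s) = 0`). -/
structure IsOsgoodModulus (w : ℝ → ℝ) : Prop where
  continuousOn : ContinuousOn w (Ici 0)
  monotoneOn : MonotoneOn w (Ici 0)
  nonneg : ∀ s, 0 ≤ s → 0 ≤ w s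
  lintegral_eq_top : ∃ r, 0 < r ∧ ∫⁻ s in Ioc 0 r, (ENNReal.ofReal (w s))⁻¹ = ⊤

end ContinuityEquation

/-! The proof is by duality. Fix a test function `ψ` and replace `b` by a field `v` that is
Lipschitz in `x`, with rate `ℓ t`. The backward transport equation `∂ₜΦ + v · ∇Φ = ψ`, with zero
data after time `T`, is solved along characteristics, and Grönwall bounds its gradient by a multiple
of `exp (∫_t ℓ)`. Testing the equation of a solution `u` with zero datum against `Φ` leaves only the
error `(v - b) · ∇Φ`, so `|∫ ψ u|` is at most a constant times `∫ ‖b - v‖ exp (∫_t ℓ) |u|`.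

Now let `v` be the spatial mollification of `b` at a scale `ε t` that varies with time. Then `‖b -
v‖ ≤ w (ε t)` and `ℓ = c * w ε / ε`: small scales make the error small but the gradient large. A
single scale need not balance the two. Instead the scales `δ / 2 ^ k` are used in succession,
coarsest near `T` and finer backward in time, each for a duration that multiplies the gradient bound
by at most `3/2`. Since `3/2 < 2`, the contributions form a convergent geometric series of total
size `O(δ)`. Osgood's condition says exactly that these durations have infinite sum, so finitely
many scales fill `[0,T]`. Letting `δ → 0` gives `∫ ψ u = 0`.

Divergence of `∫ ds / G` keeps the characteristics that meet the support of `ψ` inside a fixed ball,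
so `Φ` has compact support and `b` may be truncated to a bounded field.

The main steps are `exists_transport_solution`, `abs_integral_mul_le_of_measurable_transport`,
`exists_mollify_lipschitz`, `exists_scale_schedule` and
`ae_eq_zero_of_forall_integral_fderiv_eq_zero`. -/

section

open Filter Topology NNReal
open scoped Convolution

/-! ### Characteristics of a Lipschitz field: existence, stability, confinement. -/

section Flow

variable {E : Type*} [NormedAddCommGroup E] [InnerProductSpace ℝ E]
  {v : ℝ → E → E} {ℓ G : ℝ → ℝ} {a b : ℝ} {X Y : ℝ → E}

theorem exists_isIntegralCurveOn_Icc [CompleteSpace E] {K M : ℝ≥0}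
    (hvL : ∀ t, LipschitzWith K (v t)) (hvc : ∀ x, Continuous fun t => v t x)
    (hM : ∀ t x, ‖v t x‖ ≤ M) {t : ℝ} (ht : t ∈ Icc a b) (x : E) :
    ∃ X : ℝ → E, X t = x ∧ IsIntegralCurveOn X v (Icc a b) := by
  have hab : a ≤ b := ht.1.trans ht.2
  -- A curve of speed at most `M` cannot leave the ball of radius `M * (b - a)`, so the local
  -- existence theorem already covers the whole interval.
  have h : IsPicardLindelof v (⟨t, ht⟩ : Icc a b) x (M * (b - a).toNNReal) 0 M K :=
    { lipschitzOnWith := fun s _ => (hvL s).lipschitzOnWith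
      continuousOn := fun y _ => (hvc y).continuousOn
      norm_le := fun s _ y _ => hM s y
      mul_max_le := by
        simp only [NNReal.coe_mul, NNReal.coe_zero, sub_zero]
        rw [Real.coe_toNNReal _ (by linarith)]
        gcongr
        exact max_le (by linarith [ht.1]) (by linarith [ht.2]) }
  exact h.exists_eq_forall_mem_Icc_hasDerivWithinAt₀

theorem IsIntegralCurveOn.hasDerivAt_of_mem_Ioo (hX : IsIntegralCurveOn X v (Icc a b))
    {s : ℝ} (hs : s ∈ Ioo a b) : HasDerivAt X (v s (X s)) s :=
  (hX s (Ioo_subset_Icc_self hs)).hasDerivAt (Icc_mem_nhds hs.1 hs.2)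

/-- Grönwall: the squared distance weighted by `exp (-2 ∫ ℓ)` is nonincreasing, and squaring avoids
the singularity of the norm where the curves meet. Keeping the rate time-dependent is what later
allows the mollification scale to vary in time. -/
theorem IsIntegralCurveOn.norm_sub_le_exp_mul (hℓ : Continuous ℓ)
    (hv : ∀ s x y, ‖v s x - v s y‖ ≤ ℓ s * ‖x - y‖)
    (hX : IsIntegralCurveOn X v (Icc a b)) (hY : IsIntegralCurveOn Y v (Icc a b))
    {t s : ℝ} (ht : t ∈ Icc a b) (hs : s ∈ Icc t b) :
    ‖X s - Y s‖ ≤ Real.exp (∫ r in t..s, ℓ r) * ‖X t - Y t‖ := by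
  have hsub : Icc t b ⊆ Icc a b := Icc_subset_Icc_left ht.1
  set g : ℝ → ℝ := fun s => Real.exp (-2 * ∫ r in t..s, ℓ r) * ‖X s - Y s‖ ^ 2 with hg
  have hI : ∀ s, HasDerivAt (fun s => ∫ r in t..s, ℓ r) (ℓ s) s := fun s =>
    (hℓ.integral_hasStrictDerivAt t s).hasDerivAt
  have hgc : ContinuousOn g (Icc t b) := by
    have h1 : Continuous fun s => Real.exp (-2 * ∫ r in t..s, ℓ r) :=
      Real.continuous_exp.comp
        (continuous_const.mul (continuous_iff_continuousAt.2 fun s => (hI s).continuousAt))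
    exact h1.continuousOn.mul
      (((hX.continuousOn.mono hsub).sub (hY.continuousOn.mono hsub)).norm.pow 2)
  have hanti : AntitoneOn g (Icc t b) := by
    have hd : ∀ s ∈ interior (Icc t b), HasDerivAt g
        (Real.exp (-2 * ∫ r in t..s, ℓ r) * (-2 * ℓ s) * ‖X s - Y s‖ ^ 2
          + Real.exp (-2 * ∫ r in t..s, ℓ r)
            * (2 * inner ℝ (X s - Y s) (v s (X s) - v s (Y s)))) s := by
      intro s hs
      rw [interior_Icc] at hs
      have hs' : s ∈ Ioo a b := ⟨ht.1.trans_lt hs.1, hs.2⟩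
      exact (((hI s).const_mul (-2)).exp).mul
        ((hX.hasDerivAt_of_mem_Ioo hs').sub (hY.hasDerivAt_of_mem_Ioo hs')).norm_sq
    refine antitoneOn_of_deriv_nonpos (convex_Icc _ _) hgc
      (fun s hs => (hd s hs).differentiableAt.differentiableWithinAt) fun s hs => ?_
    rw [(hd s hs).deriv]
    have h1 : inner ℝ (X s - Y s) (v s (X s) - v s (Y s)) ≤ ℓ s * ‖X s - Y s‖ ^ 2 := by
      refine (real_inner_le_norm _ _).trans ?_
      nlinarith [hv s (X s) (Y s), norm_nonneg (X s - Y s)]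
    have h2 := Real.exp_pos (-2 * ∫ r in t..s, ℓ r)
    nlinarith
  have hts := hanti (left_mem_Icc.2 (hs.1.trans hs.2)) hs hs.1
  simp only [hg, intervalIntegral.integral_same, mul_zero, Real.exp_zero, one_mul] at hts
  have h3 : ‖X s - Y s‖ ^ 2 ≤ (Real.exp (∫ r in t..s, ℓ r) * ‖X t - Y t‖) ^ 2 := by
    have : ‖X s - Y s‖ ^ 2 = Real.exp (∫ r in t..s, ℓ r) ^ 2
        * (Real.exp (-2 * ∫ r in t..s, ℓ r) * ‖X s - Y s‖ ^ 2) := by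
      rw [← mul_assoc, ← Real.exp_nat_mul, ← Real.exp_add]
      simp
    rw [this, mul_pow]
    gcongr
  exact (abs_le_of_sq_le_sq' h3 (by positivity)).2

theorem IsIntegralCurveOn.eqOn_of_eq (hℓ : Continuous ℓ)
    (hv : ∀ s x y, ‖v s x - v s y‖ ≤ ℓ s * ‖x - y‖)
    (hX : IsIntegralCurveOn X v (Icc a b)) (hY : IsIntegralCurveOn Y v (Icc a b))
    {t : ℝ} (ht : t ∈ Icc a b) (h : X t = Y t) : EqOn X Y (Icc t b) := fun s hs => by
  simpa [h, sub_eq_zero] using hX.norm_sub_le_exp_mul hℓ hv hY ht hs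

theorem IsIntegralCurveOn.norm_sub_le {M : ℝ} (hM : ∀ t x, ‖v t x‖ ≤ M)
    (hX : IsIntegralCurveOn X v (Icc a b)) {t s : ℝ} (ht : t ∈ Icc a b) (hs : s ∈ Icc a b) :
    ‖X s - X t‖ ≤ M * |s - t| :=
  (convex_Icc a b).norm_image_sub_le_of_norm_hasDerivWithin_le hX (fun r _ => hM r (X r)) ht hs

/-- The radius `J = √(1 + ‖X‖²)`, smooth at the origin, changes at speed at most `G J`, so `∫_0^J dr
/ G` drops by at most one per unit of time. Hence a curve starting far out cannot come near the
origin within bounded time. -/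
theorem IsIntegralCurveOn.integral_inv_le (hG : Continuous G) (hG0 : ∀ s, 0 < G s)
    (hGm : MonotoneOn G (Ici 0)) (hv : ∀ t x, ‖v t x‖ ≤ G ‖x‖)
    (hX : IsIntegralCurveOn X v (Icc a b)) {t s : ℝ} (ht : t ∈ Icc a b) (hs : s ∈ Icc t b) :
    ∫ r in 0..√(1 + ‖X t‖ ^ 2), (G r)⁻¹ ≤ (∫ r in 0..√(1 + ‖X s‖ ^ 2), (G r)⁻¹) + (s - t) := by
  have hsub : Icc t b ⊆ Icc a b := Icc_subset_Icc_left ht.1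
  have hGi : Continuous fun r => (G r)⁻¹ := hG.inv₀ fun r => (hG0 r).ne'
  have hI : ∀ s, HasDerivAt (fun s => ∫ r in 0..s, (G r)⁻¹) (G s)⁻¹ s := fun s =>
    (hGi.integral_hasStrictDerivAt 0 s).hasDerivAt
  set g : ℝ → ℝ := fun s => (∫ r in 0..√(1 + ‖X s‖ ^ 2), (G r)⁻¹) + (s - t) with hg
  have hgc : ContinuousOn g (Icc t b) := by
    have h1 : Continuous fun s => ∫ r in 0..s, (G r)⁻¹ :=
      continuous_iff_continuousAt.2 fun s => (hI s).continuousAt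
    have h2 := hX.continuousOn.mono hsub
    fun_prop
  have hmono : MonotoneOn g (Icc t b) := by
    have hd : ∀ s ∈ interior (Icc t b), HasDerivAt g
        ((G √(1 + ‖X s‖ ^ 2))⁻¹ * (2 * inner ℝ (X s) (v s (X s)) / (2 * √(1 + ‖X s‖ ^ 2)))
          + 1) s := by
      intro s hs
      rw [interior_Icc] at hs
      have hs' : s ∈ Ioo a b := ⟨ht.1.trans_lt hs.1, hs.2⟩
      have h1 := ((hX.hasDerivAt_of_mem_Ioo hs').norm_sq.const_add 1).sqrt
        (by positivity : (1 + ‖X s‖ ^ 2) ≠ 0)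
      exact ((hI _).comp s h1).add ((hasDerivAt_id s).sub_const t)
    refine monotoneOn_of_deriv_nonneg (convex_Icc _ _) hgc
      (fun s hs => (hd s hs).differentiableAt.differentiableWithinAt) fun s hs => ?_
    rw [(hd s hs).deriv]
    set J := √(1 + ‖X s‖ ^ 2)
    have hJ : ‖X s‖ ≤ J := Real.le_sqrt_of_sq_le (by linarith)
    have hJ0 : 0 < J := Real.sqrt_pos.2 (by positivity)
    have h1 : |inner ℝ (X s) (v s (X s))| ≤ J * G J :=
      (abs_real_inner_le_norm _ _).trans (mul_le_mul hJ
        ((hv s _).trans (hGm (norm_nonneg _) (mem_Ici.2 hJ0.le) hJ)) (norm_nonneg _) hJ0.le)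
    have h2 : (G J)⁻¹ * (2 * inner ℝ (X s) (v s (X s)) / (2 * J)) + 1
        = (inner ℝ (X s) (v s (X s)) + J * G J) / (J * G J) := by
      have := (hG0 J).ne'
      field_simp
    rw [h2]
    exact div_nonneg (by linarith [neg_abs_le (inner ℝ (X s) (v s (X s)))])
      (mul_pos hJ0 (hG0 J)).le
  simpa [hg] using hmono (left_mem_Icc.2 (hs.1.trans hs.2)) hs hs.1

end Flow

/-! ### The dual problem, solved along characteristics. -/

section Transport

variable {E : Type*} [NormedAddCommGroup E] [InnerProductSpace ℝ E] [CompleteSpace E]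

/-- The solution is minus the integral of `ψ` along the curve from `(t, x)` up to time `b`. It is
only Lipschitz, so the equation is recorded in integrated form along curves. Grönwall gives the
Lipschitz constant and `IsIntegralCurveOn.integral_inv_le` the spatial support. -/
theorem exists_transport_solution {v : ℝ → E → E} {ℓ G : ℝ → ℝ} {a b : ℝ} {K M : ℝ≥0}
    (hab : a ≤ b) (hvL : ∀ t, LipschitzWith K (v t)) (hvc : ∀ x, Continuous fun t => v t x)
    (hM : ∀ t x, ‖v t x‖ ≤ M) (hℓ : Continuous ℓ) (hℓ0 : ∀ s, 0 ≤ ℓ s)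
    (hv : ∀ s x y, ‖v s x - v s y‖ ≤ ℓ s * ‖x - y‖)
    (hG : Continuous G) (hG0 : ∀ s, 0 < G s) (hGm : MonotoneOn G (Ici 0))
    (hvG : ∀ t x, ‖v t x‖ ≤ G ‖x‖)
    {ψ : ℝ × E → ℝ} (hψ : Continuous ψ) {P Q : ℝ} (hP : 0 ≤ P)
    (hψL : ∀ t x y, |ψ (t, x) - ψ (t, y)| ≤ P * ‖x - y‖) (hψQ : ∀ z, |ψ z| ≤ Q)
    {T₀ : ℝ} (hψT : ∀ t x, T₀ ≤ t → ψ (t, x) = 0)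
    {R R' : ℝ} (hψR : ∀ t x, R < ‖x‖ → ψ (t, x) = 0)
    (hR' : (∫ r in 0..√(1 + R ^ 2), (G r)⁻¹) + (b - a) < ∫ r in 0..R', (G r)⁻¹) :
    ∃ Φ : ℝ × E → ℝ, Continuous Φ
      ∧ (∀ t ∈ Icc a b, ∀ x y,
          |Φ (t, x) - Φ (t, y)| ≤ P * (b - a) * Real.exp (∫ r in t..b, ℓ r) * ‖x - y‖)
      ∧ (∀ t ∈ Icc a b, ∀ x, ∃ X : ℝ → E, X t = x ∧ IsIntegralCurveOn X v (Icc a b)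
          ∧ ∀ s ∈ Icc t b, Φ (s, X s) - Φ (t, x) = ∫ r in t..s, ψ (r, X r))
      ∧ (∀ t x, T₀ ≤ t → Φ (t, x) = 0) ∧ (∀ t x, R' ≤ ‖x‖ → Φ (t, x) = 0) := by
  choose! X hX0 hX using fun (t : ℝ) (ht : t ∈ Icc a b) =>
    exists_isIntegralCurveOn_Icc (v := v) hvL hvc hM ht
  have hQ : 0 ≤ Q := (abs_nonneg _).trans (hψQ (0, 0))
  set φ : ℝ × E → ℝ := fun z => -∫ r in z.1..b, ψ (r, X z.1 z.2 r) with hφ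
  have hcont : ∀ t ∈ Icc a b, ∀ x, ContinuousOn (fun r => ψ (r, X t x r)) (Icc a b) :=
    fun t ht x => hψ.comp_continuousOn (continuousOn_id.prodMk (hX t ht x).continuousOn)
  have hint : ∀ t ∈ Icc a b, ∀ x, ∀ s ∈ Icc a b, ∀ s' ∈ Icc a b,
      IntervalIntegrable (fun r => ψ (r, X t x r)) volume s s' := fun t ht x s hs s' hs' =>
    ((hcont t ht x).mono (uIcc_subset_Icc hs hs')).intervalIntegrable
  have hbb : b ∈ Icc a b := right_mem_Icc.2 hab
  have hLip : ∀ t ∈ Icc a b, ∀ x y,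
      |φ (t, x) - φ (t, y)| ≤ P * (b - a) * Real.exp (∫ r in t..b, ℓ r) * ‖x - y‖ := by
    intro t ht x y
    have h1 : φ (t, x) - φ (t, y) = ∫ r in t..b, (ψ (r, X t y r) - ψ (r, X t x r)) := by
      rw [intervalIntegral.integral_sub (hint t ht y t ht b hbb) (hint t ht x t ht b hbb)]
      simp only [hφ]; ring
    have h2 : ∀ r ∈ uIoc t b, ‖ψ (r, X t y r) - ψ (r, X t x r)‖
        ≤ P * (Real.exp (∫ r in t..b, ℓ r) * ‖x - y‖) := by
      intro r hr
      rw [uIoc_of_le ht.2] at hr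
      have hr' : r ∈ Icc t b := Ioc_subset_Icc_self hr
      refine (hψL _ _ _).trans (mul_le_mul_of_nonneg_left ?_ hP)
      refine ((hX t ht y).norm_sub_le_exp_mul hℓ hv (hX t ht x) ht hr').trans ?_
      rw [hX0 t ht, hX0 t ht, norm_sub_rev]
      gcongr
      exact intervalIntegral.integral_mono_interval le_rfl hr'.1 hr'.2
        (Eventually.of_forall hℓ0) (hℓ.intervalIntegrable _ _)
    rw [h1]
    refine (intervalIntegral.norm_integral_le_of_norm_le_const h2).trans ?_
    rw [abs_of_nonneg (by linarith [ht.2])]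
    have h3 : 0 ≤ P * (Real.exp (∫ r in t..b, ℓ r) * ‖x - y‖) := by positivity
    nlinarith [ht.1]
  have hflow : ∀ t ∈ Icc a b, ∀ x, ∀ s ∈ Icc t b,
      φ (s, X t x s) - φ (t, x) = ∫ r in t..s, ψ (r, X t x r) := by
    intro t ht x s hs
    have hs' : s ∈ Icc a b := ⟨ht.1.trans hs.1, hs.2⟩
    -- Forward uniqueness: the curve restarted at a later point is the old curve.
    have heq : EqOn (X s (X t x s)) (X t x) (Icc s b) :=
      (hX s hs' _).eqOn_of_eq hℓ hv (hX t ht x) hs' (hX0 s hs' _)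
    have h1 : φ (s, X t x s) = -∫ r in s..b, ψ (r, X t x r) := by
      simp only [hφ]
      congr 1
      refine intervalIntegral.integral_congr fun r hr => ?_
      rw [uIcc_of_le hs.2] at hr
      simp only [heq hr]
    rw [h1]
    simp only [hφ]
    rw [← intervalIntegral.integral_add_adjacent_intervals
      (hint t ht x t ht s hs') (hint t ht x s hs' b hbb)]
    ring
  have hΛ : ∀ t ∈ Icc a b, P * (b - a) * Real.exp (∫ r in t..b, ℓ r)
      ≤ P * (b - a) * Real.exp (∫ r in a..b, ℓ r) := by
    intro t ht
    have : 0 ≤ b - a := by linarith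
    gcongr
    refine intervalIntegral.integral_mono_interval ht.1 ht.2 le_rfl
      (Eventually.of_forall hℓ0) (hℓ.intervalIntegrable _ _)
  set Λ := P * (b - a) * Real.exp (∫ r in a..b, ℓ r)
  have hΛ0 : 0 ≤ Λ := mul_nonneg (mul_nonneg hP (by linarith)) (Real.exp_pos _).le
  -- To compare two times, follow the curve from `(t, x)` to time `s` and use the spatial estimate
  -- there.
  have hjoint : ∀ t ∈ Icc a b, ∀ s ∈ Icc t b, ∀ x y,
      |φ (t, x) - φ (s, y)| ≤ (Λ + Λ * M + Q) * max |t - s| ‖x - y‖ := by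
    intro t ht s hs x y
    have hs' : s ∈ Icc a b := ⟨ht.1.trans hs.1, hs.2⟩
    have h1 : |∫ r in t..s, ψ (r, X t x r)| ≤ Q * |s - t| := by
      have := intervalIntegral.norm_integral_le_of_norm_le_const (a := t) (b := s) (C := Q)
        (f := fun r => ψ (r, X t x r)) fun r _ => hψQ _
      rwa [Real.norm_eq_abs] at this
    have h2 := (hLip s hs' (X t x s) y).trans
      (mul_le_mul_of_nonneg_right (hΛ s hs') (norm_nonneg _))
    have h3 : ‖X t x s - y‖ ≤ M * |s - t| + ‖x - y‖ := by
      have := (hX t ht x).norm_sub_le hM ht hs'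
      rw [hX0 t ht] at this
      calc ‖X t x s - y‖ = ‖(X t x s - x) + (x - y)‖ := by congr 1; abel
        _ ≤ _ := (norm_add_le _ _).trans (by gcongr)
    have h4 : φ (t, x) - φ (s, y)
        = (φ (s, X t x s) - φ (s, y)) - ∫ r in t..s, ψ (r, X t x r) := by
      rw [← hflow t ht x s hs]; ring
    rw [h4]
    refine (abs_sub _ _).trans ?_
    have h5 := le_max_left |t - s| ‖x - y‖
    have h6 := le_max_right |t - s| ‖x - y‖
    rw [abs_sub_comm s t] at h1 h3
    have h7 : Λ * ‖X t x s - y‖ ≤ Λ * (M * max |t - s| ‖x - y‖ + max |t - s| ‖x - y‖) := by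
      gcongr
      refine h3.trans (by gcongr)
    have h8 : Q * |t - s| ≤ Q * max |t - s| ‖x - y‖ := by gcongr
    nlinarith
  have hLipOn : LipschitzOnWith (Λ + Λ * M + Q).toNNReal φ (Icc a b ×ˢ univ) := by
    refine LipschitzOnWith.of_dist_le_mul fun z hz z' hz' => ?_
    rw [Real.coe_toNNReal _ (by positivity), Real.dist_eq, Prod.dist_eq, Real.dist_eq, dist_eq_norm]
    obtain ⟨t, x⟩ := z
    obtain ⟨s, y⟩ := z'
    rcases le_total t s with h | h
    · exact hjoint t hz.1 s ⟨h, hz'.1.2⟩ x y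
    · rw [abs_sub_comm, abs_sub_comm t, norm_sub_rev]
      exact hjoint s hz'.1 t ⟨h, hz.1.2⟩ y x
  have hproj : ∀ t ∈ Icc a b, (projIcc a b hab t : ℝ) = t := fun t ht => by
    rw [projIcc_of_mem hab ht]
  -- Clamping the time to `[a, b]` makes the function continuous everywhere, as convolution
  -- requires.
  refine ⟨fun z => φ (projIcc a b hab z.1, z.2), ?_, ?_, ?_, ?_, ?_⟩
  · refine hLipOn.continuousOn.comp_continuous ?_ fun z => ⟨(projIcc a b hab z.1).2, mem_univ _⟩
    exact (continuous_subtype_val.comp (continuous_projIcc.comp continuous_fst)).prodMk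
      continuous_snd
  · intro t ht x y
    simp only [hproj t ht]
    exact hLip t ht x y
  · intro t ht x
    refine ⟨X t x, hX0 t ht x, hX t ht x, fun s hs => ?_⟩
    simp only [hproj t ht, hproj s ⟨ht.1.trans hs.1, hs.2⟩]
    exact hflow t ht x s hs
  · intro t x h
    simp only [hφ, neg_eq_zero]
    set c := projIcc a b hab t with hc
    refine intervalIntegral.integral_zero_ae (Eventually.of_forall fun r hr => hψT _ _ ?_)
    rw [uIoc_of_le c.2.2] at hr
    rcases le_total t b with htb | htb
    · refine h.trans (le_trans ?_ hr.1.le)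
      rw [hc, coe_projIcc]
      simp [htb]
    · rw [projIcc_of_right_le hab htb] at hc
      rw [hc] at hr
      exact absurd hr.1 (not_lt.2 hr.2)
  · intro t x h
    simp only [hφ, neg_eq_zero]
    set c := projIcc a b hab t
    refine intervalIntegral.integral_zero_ae (Eventually.of_forall fun r hr => hψR _ _ ?_)
    rw [uIoc_of_le c.2.2] at hr
    -- If the curve from a point outside radius `R'` entered the ball of radius `R`, then `∫ dr / G`
    -- would have dropped by more than `b - a`, against `hR'`.
    by_contra! hle
    have h1 := (hX c c.2 x).integral_inv_le hG hG0 hGm hvG c.2 (Ioc_subset_Icc_self hr)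
    rw [hX0 c c.2] at h1
    have hGi : Continuous fun r => (G r)⁻¹ := hG.inv₀ fun r => (hG0 r).ne'
    have hmono : Monotone fun s => ∫ r in 0..s, (G r)⁻¹ := by
      refine monotone_of_deriv_nonneg
        (fun s => (hGi.integral_hasStrictDerivAt 0 s).hasDerivAt.differentiableAt) fun s => ?_
      rw [(hGi.integral_hasStrictDerivAt 0 s).hasDerivAt.deriv]
      exact (inv_pos.2 (hG0 s)).le
    have h2 : R' ≤ √(1 + ‖x‖ ^ 2) := h.trans (Real.le_sqrt_of_sq_le (by linarith))
    have h3 : √(1 + ‖X c x r‖ ^ 2) ≤ √(1 + R ^ 2) := by gcongr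
    have h4 := hmono h2
    have h5 := hmono h3
    simp only at h4 h5
    have h6 := c.2.1
    linarith [hr.2]

end Transport

/-! ### Mollifying the dual solution in space-time. -/

section Mollify

/-- A mollification averages translates against a probability density, so an increment estimate
valid for all small translates survives with the same constant. -/
theorem ContDiffBump.abs_convolution_sub_le {F : Type*} [NormedAddCommGroup F] [NormedSpace ℝ F]
    [FiniteDimensional ℝ F] [MeasurableSpace F] [BorelSpace F] (μ : Measure F)
    [μ.IsAddHaarMeasure] (ρ : ContDiffBump (0 : F)) {Φ : F → ℝ} (hΦ : Continuous Φ) {p p' : F}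
    {c κ : ℝ} (hκ : 0 ≤ κ)
    (h : ∀ q ∈ Metric.ball (0 : F) ρ.rOut, |Φ (p' - q) - Φ (p - q) - c| ≤ κ) :
    |(ρ.normed μ ⋆[ContinuousLinearMap.lsmul ℝ ℝ, μ] Φ) p'
      - (ρ.normed μ ⋆[ContinuousLinearMap.lsmul ℝ ℝ, μ] Φ) p - c| ≤ κ := by
  have hint : ∀ z : F, Integrable (fun q => ρ.normed μ q • Φ (z - q)) μ := fun z =>
    (ρ.continuous_normed.smul (by fun_prop)).integrable_of_hasCompactSupport
      ρ.hasCompactSupport_normed.smul_right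
  have hd := dist_convolution_le (μ := μ) (f := ρ.normed μ) (x₀ := p) (z₀ := c)
    (g := fun q => Φ (p' - p + q) - Φ q) (R := ρ.rOut) hκ ρ.support_normed_eq.subset
    ρ.nonneg_normed (ρ.integral_normed) (by fun_prop) (fun z hz => by
      have := h (p - z) (by simpa [dist_eq_norm, norm_sub_rev] using hz)
      rw [Real.dist_eq]
      convert! this using 5 <;> abel)
  rw [Real.dist_eq] at hd
  convert! hd using 3
  simp only [convolution_def, ContinuousLinearMap.lsmul_apply]
  rw [← integral_sub (hint _) (hint _)]
  refine integral_congr_ae (Eventually.of_forall fun q => ?_)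
  simp only [smul_eq_mul]
  rw [show p' - p + (p - q) = p' - q by abel]
  ring

variable {E : Type*} [NormedAddCommGroup E] [InnerProductSpace ℝ E] [FiniteDimensional ℝ E]
  [MeasurableSpace E] [BorelSpace E]

/-- Positive increments suffice because `f` is differentiable; characteristics are only followed
forward in time. -/
theorem abs_fderiv_le_of_forall_abs_sub_le {F : Type*} [NormedAddCommGroup F] [NormedSpace ℝ F]
    {f : F → ℝ} {p e : F} (hf : DifferentiableAt ℝ f p) {c κ h₀ : ℝ} (hh₀ : 0 < h₀)
    (h : ∀ s ∈ Ioo 0 h₀, |f (p + s • e) - f p - s * c| ≤ s * κ) :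
    |fderiv ℝ f p e - c| ≤ κ := by
  have h1 : HasDerivAt (fun s : ℝ => f (p + s • e)) (fderiv ℝ f p e) 0 := by
    have h2 : HasDerivAt (fun s : ℝ => p + s • e) e 0 := by
      simpa using ((hasDerivAt_id (0 : ℝ)).smul_const e).const_add p
    have h3 : HasFDerivAt f (fderiv ℝ f p) (p + (0 : ℝ) • e) := by
      simpa using hf.hasFDerivAt
    exact h3.comp_hasDerivAt 0 h2
  have h4 := hasDerivWithinAt_iff_tendsto_slope.1 (h1.hasDerivWithinAt (s := Ioi 0))
  rw [show Ioi (0 : ℝ) \ {0} = Ioi 0 by simp] at h4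
  refine le_of_tendsto (h4.sub_const c).abs ?_
  filter_upwards [Ioo_mem_nhdsGT hh₀] with s hs
  have h5 := h s hs
  rw [slope_def_field]
  simp only [zero_smul, add_zero, sub_zero]
  have h6 : (f (p + s • e) - f p) / s - c = (f (p + s • e) - f p - s * c) / s := by
    field_simp [hs.1.ne']
  rw [h6, abs_div, abs_of_pos hs.1, div_le_iff₀ hs.1]
  linarith

theorem abs_fderiv_convolution_snd_le (μ : Measure (ℝ × E)) [μ.IsAddHaarMeasure]
    (ρ : ContDiffBump (0 : ℝ × E)) {Φ : ℝ × E → ℝ} (hΦ : Continuous Φ) {t : ℝ} {Λ : ℝ}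
    (hΛ : 0 ≤ Λ)
    (h : ∀ s, |s - t| < ρ.rOut → ∀ x y, |Φ (s, x) - Φ (s, y)| ≤ Λ * ‖x - y‖) (x y : E) :
    |fderiv ℝ (ρ.normed μ ⋆[ContinuousLinearMap.lsmul ℝ ℝ, μ] Φ) (t, x) (0, y)| ≤ Λ * ‖y‖ := by
  have hf : ContDiff ℝ 1 (ρ.normed μ ⋆[ContinuousLinearMap.lsmul ℝ ℝ, μ] Φ) :=
    ρ.hasCompactSupport_normed.contDiff_convolution_left _ ρ.contDiff_normed
      hΦ.locallyIntegrable
  have := abs_fderiv_le_of_forall_abs_sub_le (p := (t, x)) (e := ((0 : ℝ), y)) (c := 0)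
    (κ := Λ * ‖y‖) (hf.differentiable one_ne_zero _) one_pos fun s hs => ?_
  · simpa using this
  refine ρ.abs_convolution_sub_le μ hΦ (mul_nonneg hs.1.le (by positivity)) fun q hq => ?_
  rw [mem_ball_zero_iff, Prod.norm_def, max_lt_iff] at hq
  have h1 := h (t - q.1) (by simpa using hq.1) (x + s • y - q.2) (x - q.2)
  simp only [mul_zero, sub_zero]
  have h2 : x + s • y - q.2 - (x - q.2) = s • y := by abel
  rw [h2, norm_smul, Real.norm_of_nonneg hs.1.le] at h1
  convert! h1 using 1
  · congr 3; ext <;> simp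
  · ring

/-- For each translate, compare the straight step `h • (1, v t x)` with the characteristic of the
same duration. The endpoints differ by at most `κ * h`, which costs `Λ * κ * h`, and the integral of
`ψ` along the curve differs from `h * ψ (t, x)` by at most `κ * h`. The small oscillation of `v`
takes the place of a commutator estimate. -/
theorem abs_fderiv_convolution_sub_le (μ : Measure (ℝ × E)) [μ.IsAddHaarMeasure]
    (ρ : ContDiffBump (0 : ℝ × E)) {Φ ψ : ℝ × E → ℝ} (hΦ : Continuous Φ) (hψ : Continuous ψ)
    {v : ℝ → E → E} {M : ℝ}
    (hM : ∀ t x, ‖v t x‖ ≤ M) {a b Λ : ℝ} (hΛ : 0 ≤ Λ)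
    (hΦL : ∀ t ∈ Icc a b, ∀ x y, |Φ (t, x) - Φ (t, y)| ≤ Λ * ‖x - y‖)
    (hΦX : ∀ t ∈ Icc a b, ∀ x, ∃ X : ℝ → E, X t = x ∧ IsIntegralCurveOn X v (Icc a b)
          ∧ ∀ s ∈ Icc t b, Φ (s, X s) - Φ (t, x) = ∫ r in t..s, ψ (r, X r))
    {t : ℝ} {x : E} (ha : a ≤ t - ρ.rOut) (hb : t + ρ.rOut < b) {r κ : ℝ} (hκ : 0 ≤ κ)
    (hr : ρ.rOut < r)
    (hosc : ∀ z : ℝ × E, dist z (t, x) < r →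
      |ψ z - ψ (t, x)| ≤ κ ∧ ‖v z.1 z.2 - v t x‖ ≤ κ) :
    |fderiv ℝ (ρ.normed μ ⋆[ContinuousLinearMap.lsmul ℝ ℝ, μ] Φ) (t, x) (1, v t x) - ψ (t, x)|
      ≤ κ + Λ * κ := by
  have hf : ContDiff ℝ 1 (ρ.normed μ ⋆[ContinuousLinearMap.lsmul ℝ ℝ, μ] Φ) :=
    ρ.hasCompactSupport_normed.contDiff_convolution_left _ ρ.contDiff_normed
      hΦ.locallyIntegrable
  have hM0 : 0 ≤ M := (norm_nonneg _).trans (hM t x)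
  -- The first bound keeps the translated step before time `b`; the second keeps its curve within
  -- the `r`-ball where the oscillation is controlled.
  obtain ⟨h₀, hh₀, hh1, hh2⟩ : ∃ h₀ > 0, h₀ ≤ b - (t + ρ.rOut) ∧ h₀ * (1 + M) ≤ r - ρ.rOut := by
    refine ⟨min (b - (t + ρ.rOut)) ((r - ρ.rOut) / (1 + M)), ?_, min_le_left _ _, ?_⟩
    · exact lt_min (by linarith) (div_pos (by linarith) (by linarith))
    · calc _ ≤ (r - ρ.rOut) / (1 + M) * (1 + M) := by gcongr; exact min_le_right _ _
        _ = _ := by field_simp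
  refine abs_fderiv_le_of_forall_abs_sub_le (hf.differentiable one_ne_zero _) hh₀ fun h hh => ?_
  have hh0 := hh.1.le
  refine ρ.abs_convolution_sub_le μ hΦ (mul_nonneg hh0 (by positivity)) fun q hq => ?_
  rw [mem_ball_zero_iff, Prod.norm_def, max_lt_iff] at hq
  obtain ⟨hq1, hq2⟩ := hq
  rw [Real.norm_eq_abs, abs_lt] at hq1
  set t' := t - q.1 with ht'
  set x' := x - q.2 with hx'
  have htI : t' ∈ Icc a b := ⟨by linarith, by linarith⟩
  have htI' : t' + h ∈ Icc a b := ⟨by linarith, by linarith [hh.2]⟩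
  obtain ⟨X, hX0, hX, hXΦ⟩ := hΦX t' htI x'
  have hsub : Icc t' (t' + h) ⊆ Icc a b := Icc_subset_Icc htI.1 htI'.2
  have hnear : ∀ s ∈ Icc t' (t' + h), dist (s, X s) (t, x) < r := by
    intro s hs
    have h1 := hX.norm_sub_le hM htI (hsub hs)
    rw [hX0, abs_of_nonneg (by linarith [hs.1])] at h1
    have h2 : M * (s - t') ≤ M * h := by gcongr; linarith [hs.2]
    have h3 : h * (1 + M) < r - ρ.rOut := by
      refine lt_of_lt_of_le ?_ hh2
      exact mul_lt_mul_of_pos_right hh.2 (by linarith)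
    have h4 : 0 ≤ M * h := mul_nonneg hM0 hh0
    rw [Prod.dist_eq, max_lt_iff, Real.dist_eq, dist_eq_norm, abs_lt]
    refine ⟨⟨by linarith [hs.1], by linarith [hs.2]⟩, ?_⟩
    calc ‖X s - x‖ = ‖(X s - x') - q.2‖ := by rw [hx']; congr 1; abel
      _ ≤ ‖X s - x'‖ + ‖q.2‖ := norm_sub_le _ _
      _ < r := by linarith
  have hXc : ContinuousOn (fun s => (s, X s)) (Icc t' (t' + h)) :=
    continuousOn_id.prodMk (hX.continuousOn.mono hsub)
  have hle : t' ≤ t' + h := by linarith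
  have e1 : |(∫ s in t'..(t' + h), ψ (s, X s)) - h * ψ (t, x)| ≤ κ * h := by
    have h1 : (∫ s in t'..(t' + h), ψ (s, X s)) - h * ψ (t, x)
        = ∫ s in t'..(t' + h), (ψ (s, X s) - ψ (t, x)) := by
      rw [intervalIntegral.integral_sub _ intervalIntegrable_const]
      · simp
      · refine ContinuousOn.intervalIntegrable ?_
        rw [uIcc_of_le hle]
        exact hψ.comp_continuousOn hXc
    rw [h1]
    have := intervalIntegral.norm_integral_le_of_norm_le_const (a := t') (b := t' + h) (C := κ)
      (f := fun s => ψ (s, X s) - ψ (t, x)) fun s hs => by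
        rw [uIoc_of_le hle] at hs
        exact (hosc _ (hnear s (Ioc_subset_Icc_self hs))).1
    simpa [abs_of_nonneg hh0] using this
  have e2 : ‖X (t' + h) - (x' + h • v t x)‖ ≤ κ * h := by
    have := (convex_Icc t' (t' + h)).norm_image_sub_le_of_norm_hasDerivWithin_le
      (f := fun s => X s - s • v t x) (f' := fun s => v s (X s) - v t x) (C := κ)
      (fun s hs => ((hX s (hsub hs)).mono hsub).sub
        (by simpa using ((hasDerivAt_id s).smul_const (v t x)).hasDerivWithinAt))
      (fun s hs => (hosc _ (hnear s hs)).2) (left_mem_Icc.2 hle) (right_mem_Icc.2 hle)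
    rw [hX0, add_sub_cancel_left, Real.norm_of_nonneg hh0] at this
    convert! this using 2
    rw [add_smul]; abel
  have e3 := (hΦL (t' + h) htI' (x' + h • v t x) (X (t' + h)))
  have e4 := hXΦ (t' + h) ⟨hle, htI'.2⟩
  rw [norm_sub_rev] at e3
  have e5 : Λ * ‖X (t' + h) - (x' + h • v t x)‖ ≤ Λ * (κ * h) := by gcongr
  have e6 : ((t, x) + h • ((1 : ℝ), v t x) - q) = (t' + h, x' + h • v t x) := by
    ext
    · simp [ht']; ring
    · simp only [hx', Prod.snd_sub, Prod.snd_add, Prod.smul_snd]; abel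
  have e7 : ((t, x) - q) = (t', x') := rfl
  rw [e6, e7]
  rw [abs_le] at e1 e3 ⊢
  constructor <;> nlinarith [e1.1, e1.2, e3.1, e3.2]

end Mollify

theorem ContDiff.exists_norm_fderiv_le {F : Type*} [NormedAddCommGroup F] [NormedSpace ℝ F]
    {φ : F → ℝ} (hφ : ContDiff ℝ ∞ φ) (hφK : HasCompactSupport φ) :
    ∃ D, ∀ z, ‖fderiv ℝ φ z‖ ≤ D :=
  (hφK.fderiv ℝ).exists_bound_of_continuous (hφ.continuous_fderiv (by simp))

/-! ### The duality estimate for a field continuous in time. -/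

section Duality

variable {E : Type*} [NormedAddCommGroup E] [InnerProductSpace ℝ E] [FiniteDimensional ℝ E]
  [MeasureSpace E] [BorelSpace E] [(volume : Measure E).IsAddHaarMeasure]

/-- This makes an admissible test function out of the Lipschitz dual solution. The equation and the
pointwise-in-time gradient bound hold up to an arbitrary `κ`. -/
theorem exists_testFunction_of_transport {T : ℝ} (hT : 0 < T)
    {v : ℝ → E → E} {ℓ G : ℝ → ℝ} {K M : ℝ≥0}
    (hvL : ∀ t, LipschitzWith K (v t)) (hvc : ∀ x, Continuous fun t => v t x)
    (hM : ∀ t x, ‖v t x‖ ≤ M) (hℓ : Continuous ℓ) (hℓ0 : ∀ s, 0 ≤ ℓ s)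
    (hv : ∀ s x y, ‖v s x - v s y‖ ≤ ℓ s * ‖x - y‖)
    (hG : Continuous G) (hG0 : ∀ s, 0 < G s) (hGm : MonotoneOn G (Ici 0))
    (hvG : ∀ t x, ‖v t x‖ ≤ G ‖x‖)
    {ψ : ℝ × E → ℝ} (hψ : Continuous ψ) {P Q : ℝ} (hP : 0 ≤ P)
    (hψL : ∀ t x y, |ψ (t, x) - ψ (t, y)| ≤ P * ‖x - y‖) (hψQ : ∀ z, |ψ z| ≤ Q)
    {T₀ : ℝ} (hT₀ : T₀ < T) (hψT : ∀ t x, T₀ ≤ t → ψ (t, x) = 0)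
    {R R' : ℝ} (hRR' : R ≤ R') (hψR : ∀ t x, R < ‖x‖ → ψ (t, x) = 0)
    (hR' : (∫ r in 0..√(1 + R ^ 2), (G r)⁻¹) + (T + 2) < ∫ r in 0..R', (G r)⁻¹)
    {κ : ℝ} (hκ : 0 < κ) :
    ∃ φ : ℝ × E → ℝ, ContDiff ℝ ∞ φ ∧ HasCompactSupport φ
      ∧ tsupport φ ⊆ Iio T ×ˢ Metric.ball 0 (R' + 1)
      ∧ ∀ t ∈ Ioo 0 T, ∀ x, |fderiv ℝ φ (t, x) (1, v t x) - ψ (t, x)| ≤ κ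
        ∧ ∀ y, |fderiv ℝ φ (t, x) (0, y)|
          ≤ (P * (T + 2) * Real.exp (∫ r in t..T + 1, ℓ r) + κ) * ‖y‖ := by
  have : (volume : Measure (ℝ × E)).IsAddHaarMeasure :=
    Measure.prod.instIsAddHaarMeasure volume volume
  have hb : T + 1 - (-1) = T + 2 := by ring
  -- One extra unit of time on each side of `[0, T]` leaves room for mollifying in time; this is the
  -- source of the factor `T + 2`.
  obtain ⟨Φ, hΦ, hΦL, hΦX, hΦT, hΦR⟩ := exists_transport_solution (a := -1) (b := T + 1)
    (by linarith) hvL hvc hM hℓ hℓ0 hv hG hG0 hGm hvG hψ hP hψL hψQ hψT hψR (by rwa [hb])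
  rw [hb] at hΦL
  set Λ : ℝ → ℝ := fun t => P * (T + 2) * Real.exp (∫ r in t..T + 1, ℓ r) with hΛ
  have hΛc : Continuous Λ := by
    have h1 : Continuous fun t => ∫ r in t..T + 1, ℓ r := by
      simp_rw [intervalIntegral.integral_symm (T + 1)]
      exact (intervalIntegral.continuous_primitive
        (fun a b => hℓ.intervalIntegrable a b) _).neg
    fun_prop
  have hΛ0 : ∀ t, 0 ≤ Λ t := fun t => by positivity
  have hΛmono : ∀ t ∈ Icc (-1) (T + 1), Λ t ≤ Λ (-1) := by
    intro t ht
    simp only [hΛ]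
    gcongr
    exact intervalIntegral.integral_mono_interval ht.1 ht.2 le_rfl
      (Eventually.of_forall hℓ0) (hℓ.intervalIntegrable _ _)
  have hvc' : Continuous fun z : ℝ × E => v z.1 z.2 :=
    continuous_prod_of_continuous_lipschitzWith' (fun z : ℝ × E => v z.1 z.2) K hvL hvc
  -- Chosen so that the mollification error `κ' + Λ (-1) * κ'` is exactly `κ`, where `Λ (-1)` is the
  -- largest Lipschitz constant.
  set κ' := κ / (1 + Λ (-1)) with hκ'
  have hκ'0 : 0 < κ' := div_pos hκ (by linarith [hΛ0 (-1)])
  have hκ'κ : κ' + Λ (-1) * κ' = κ := by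
    rw [hκ']; field_simp [(by linarith [hΛ0 (-1)] : 1 + Λ (-1) ≠ 0)]
  have hκ'le : κ' ≤ κ := by nlinarith [mul_nonneg (hΛ0 (-1)) hκ'0.le]
  obtain ⟨r, hr0, hr⟩ : ∃ r > 0, ∀ z ∈ Icc 0 T ×ˢ Metric.closedBall (0 : E) (R' + 1),
      ∀ z', dist z' z < r → |ψ z' - ψ z| ≤ κ' ∧ ‖v z'.1 z'.2 - v z.1 z.2‖ ≤ κ'
        ∧ |Λ z'.1 - Λ z.1| ≤ κ' := by
    have hK : IsCompact (Icc 0 T ×ˢ Metric.closedBall (0 : E) (R' + 1)) :=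
      isCompact_Icc.prod (isCompact_closedBall _ _)
    have := hK.uniformContinuousAt_of_continuousAt
      (fun z : ℝ × E => (ψ z, v z.1 z.2, Λ z.1)) (fun z _ => by fun_prop)
      (Metric.dist_mem_uniformity hκ'0)
    obtain ⟨r, hr0, hr⟩ := Metric.mem_uniformity_dist.1 this
    refine ⟨r, hr0, fun z hz z' hz' => ?_⟩
    have h1 := hr (a := z) (b := z') (by rwa [dist_comm]) hz
    change dist (ψ z, v z.1 z.2, Λ z.1) (ψ z', v z'.1 z'.2, Λ z'.1) < κ' at h1
    rw [Prod.dist_eq, Prod.dist_eq, max_lt_iff, max_lt_iff, Real.dist_eq, dist_eq_norm,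
      Real.dist_eq] at h1
    refine ⟨?_, ?_, ?_⟩
    · rw [abs_sub_comm]; exact h1.1.le
    · rw [norm_sub_rev]; exact h1.2.1.le
    · rw [abs_sub_comm]; exact h1.2.2.le
  obtain ⟨δ, hδ0, hδ⟩ : ∃ δ > 0, δ < 1 / 2 ∧ δ < r ∧ T₀ + δ < T := by
    refine ⟨min (1 / 4) (min (r / 2) ((T - T₀) / 2)), ?_, ?_, ?_, ?_⟩
    · exact lt_min (by norm_num) (lt_min (by linarith) (by linarith))
    · exact (min_le_left _ _).trans_lt (by norm_num)
    · exact ((min_le_right _ _).trans (min_le_left _ _)).trans_lt (by linarith)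
    · linarith [(min_le_right (1 / 4 : ℝ) (min (r / 2) ((T - T₀) / 2))).trans (min_le_right _ _)]
  obtain ⟨hδ1, hδr, hδT⟩ := hδ
  set ρ : ContDiffBump (0 : ℝ × E) := ⟨δ / 2, δ, by linarith, by linarith⟩
  have hρ : ρ.rOut = δ := rfl
  set f : ℝ × E → ℝ := ρ.normed (volume : Measure (ℝ × E)) ⋆[ContinuousLinearMap.lsmul ℝ ℝ,
    (volume : Measure (ℝ × E))] Φ with hf
  have hfC : ContDiff ℝ ∞ f :=
    ρ.hasCompactSupport_normed.contDiff_convolution_left _ ρ.contDiff_normed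
      hΦ.locallyIntegrable
  have hf0 : ∀ z, (∀ q ∈ Metric.ball (0 : ℝ × E) δ, Φ (z - q) = 0) → f z = 0 := by
    intro z hz
    simp only [hf, convolution_def, ContinuousLinearMap.lsmul_apply]
    refine integral_eq_zero_of_ae (Eventually.of_forall fun q => ?_)
    by_cases hq : q ∈ Metric.ball (0 : ℝ × E) δ
    · simp [hz q hq]
    · have : q ∉ Function.support (ρ.normed (volume : Measure (ℝ × E))) := by
        rwa [ρ.support_normed_eq]
      simp [Function.notMem_support.1 this]
  have hball : ∀ q ∈ Metric.ball (0 : ℝ × E) δ, |q.1| < δ ∧ ‖q.2‖ < δ := fun q hq => by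
    rwa [mem_ball_zero_iff, Prod.norm_def, max_lt_iff] at hq
  have hfT : ∀ t x, T₀ + δ ≤ t → f (t, x) = 0 := fun t x h => hf0 _ fun q hq =>
    hΦT _ _ (by
      have := abs_lt.1 (hball q hq).1
      change T₀ ≤ t - q.1
      linarith)
  have hfR : ∀ t x, R' + δ ≤ ‖x‖ → f (t, x) = 0 := fun t x h => hf0 _ fun q hq =>
    hΦR _ _ (by
      have := (hball q hq).2
      change R' ≤ ‖x - q.2‖
      linarith [norm_sub_norm_le x q.2])
  -- The cutoff is `1` for `t ≥ 0` and vanishes for `t ≤ -1`: it makes the support compact without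
  -- changing anything on `(0, T)`.
  set χ : ℝ × E → ℝ := fun z => Real.smoothTransition (z.1 + 1) with hχ
  have hχC : ContDiff ℝ ∞ χ := Real.smoothTransition.contDiff.comp (by fun_prop)
  have hφz : ∀ z, χ z * f z ≠ 0 → z ∈ Icc (-1) (T₀ + δ) ×ˢ Metric.closedBall (0 : E) (R' + δ) := by
    intro z hz
    have h1 : χ z ≠ 0 := left_ne_zero_of_mul hz
    have h2 : f (z.1, z.2) ≠ 0 := right_ne_zero_of_mul hz
    refine ⟨⟨?_, ?_⟩, ?_⟩
    · by_contra! h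
      exact h1 (Real.smoothTransition.zero_of_nonpos (by linarith))
    · by_contra! h
      exact h2 (hfT _ _ h.le)
    · rw [mem_closedBall_zero_iff]
      by_contra! h
      exact h2 (hfR _ _ h.le)
  have hts : tsupport (fun z => χ z * f z)
      ⊆ Icc (-1) (T₀ + δ) ×ˢ Metric.closedBall (0 : E) (R' + δ) :=
    closure_minimal (fun z hz => hφz z hz) (isClosed_Icc.prod Metric.isClosed_closedBall)
  refine ⟨fun z => χ z * f z, hχC.mul hfC, ?_, ?_, ?_⟩
  · exact (isCompact_Icc.prod (isCompact_closedBall _ _)).of_isClosed_subset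
      (isClosed_tsupport _) hts
  · refine hts.trans (prod_mono (fun t ht => lt_of_le_of_lt ht.2 hδT)
      (Metric.closedBall_subset_ball (by linarith)))
  · intro t ht x
    have heq : (fun z => χ z * f z) =ᶠ[𝓝 (t, x)] f := by
      have : ∀ᶠ z : ℝ × E in 𝓝 (t, x), 0 < z.1 :=
        continuous_fst.continuousAt.eventually (lt_mem_nhds ht.1)
      filter_upwards [this] with z hz
      simp [hχ, Real.smoothTransition.one_of_one_le (by linarith : 1 ≤ z.1 + 1)]
    rw [heq.fderiv_eq]
    by_cases hx : ‖x‖ ≤ R' + 1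
    · have hz : (t, x) ∈ Icc 0 T ×ˢ Metric.closedBall (0 : E) (R' + 1) :=
        ⟨Ioo_subset_Icc_self ht, by simpa using hx⟩
      constructor
      · rw [← hκ'κ]
        refine abs_fderiv_convolution_sub_le volume ρ hΦ hψ hM (a := -1) (b := T + 1) (hΛ0 _)
          (fun s hs y y' => (hΦL s hs y y').trans
            (mul_le_mul_of_nonneg_right (hΛmono s hs) (norm_nonneg _)))
          hΦX ?_ ?_ hκ'0.le (r := r) hδr fun z' hz' => ⟨(hr _ hz z' hz').1, (hr _ hz z' hz').2.1⟩
        · rw [hρ]; linarith [ht.1]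
        · rw [hρ]; linarith [ht.2]
      · intro y
        refine abs_fderiv_convolution_snd_le volume ρ hΦ (by linarith [hΛ0 t] : 0 ≤ Λ t + κ) ?_ x y
        intro s hs y y'
        rw [hρ, abs_lt] at hs
        have hsI : s ∈ Icc (-1) (T + 1) := ⟨by linarith [ht.1], by linarith [ht.2]⟩
        refine (hΦL s hsI y y').trans (mul_le_mul_of_nonneg_right ?_ (norm_nonneg _))
        have h1 := (hr _ hz (s, x) (by
          simp only [Prod.dist_eq, dist_self, Real.dist_eq]
          exact max_lt (abs_lt.2 ⟨by linarith, by linarith⟩) hr0)).2.2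
        have h2 := abs_le.1 h1
        change Λ s ≤ Λ t + κ
        simp only at h2
        linarith
    · push Not at hx
      have heq0 : f =ᶠ[𝓝 (t, x)] fun _ => 0 := by
        have : ∀ᶠ z : ℝ × E in 𝓝 (t, x), R' + δ < ‖z.2‖ :=
          (continuous_snd.norm).continuousAt.eventually (lt_mem_nhds (by simpa using by linarith))
        filter_upwards [this] with z hz
        exact hfR z.1 z.2 hz.le
      rw [heq0.fderiv_eq, hψR t x (by linarith)]
      simp only [fderiv_fun_const, Pi.zero_apply, _root_.zero_apply, sub_zero,
        abs_zero]
      refine ⟨hκ.le, fun y => mul_nonneg (by linarith [hΛ0 t]) (norm_nonneg _)⟩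

/-- Subtracting the weak equation for a near-solution `φ` of the dual problem turns `∫ ψ u` into the
integral of `(v - b) · ∇φ` against `u`, up to `O(κ)`. The gradient bound and `κ → 0` finish. -/
theorem abs_integral_mul_le_of_transport {T : ℝ} (hT : 0 < T)
    {v : ℝ → E → E} {ℓ G : ℝ → ℝ} {K M : ℝ≥0}
    (hvL : ∀ t, LipschitzWith K (v t)) (hvc : ∀ x, Continuous fun t => v t x)
    (hM : ∀ t x, ‖v t x‖ ≤ M) (hℓ : Continuous ℓ) (hℓ0 : ∀ s, 0 ≤ ℓ s)
    (hv : ∀ s x y, ‖v s x - v s y‖ ≤ ℓ s * ‖x - y‖)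
    (hG : Continuous G) (hG0 : ∀ s, 0 < G s) (hGm : MonotoneOn G (Ici 0))
    (hvG : ∀ t x, ‖v t x‖ ≤ G ‖x‖)
    {ψ : ℝ × E → ℝ} (hψ : Continuous ψ) {P Q : ℝ} (hP : 0 ≤ P)
    (hψL : ∀ t x y, |ψ (t, x) - ψ (t, y)| ≤ P * ‖x - y‖) (hψQ : ∀ z, |ψ z| ≤ Q)
    {T₀ : ℝ} (hT₀ : T₀ < T) (hψT : ∀ t x, T₀ ≤ t → ψ (t, x) = 0)
    {R R' : ℝ} (hRR' : R ≤ R') (hψR : ∀ t x, R < ‖x‖ → ψ (t, x) = 0)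
    (hR' : (∫ r in 0..√(1 + R ^ 2), (G r)⁻¹) + (T + 2) < ∫ r in 0..R', (G r)⁻¹)
    {b : ℝ × E → E} (hb : Measurable b) {N : ℝ} (hbN : ∀ z, ‖b z‖ ≤ N)
    {u : ℝ × E → ℝ} (hu : Integrable u ((volume.restrict (Ioo 0 T)).prod volume))
    (hweak : ∀ φ : ℝ × E → ℝ, ContDiff ℝ ∞ φ → HasCompactSupport φ →
      tsupport φ ⊆ Iio T ×ˢ Metric.ball 0 (R' + 1) →
      ∫ z, fderiv ℝ φ z (1, b z) * u z ∂((volume.restrict (Ioo 0 T)).prod volume) = 0) :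
    |∫ z, ψ z * u z ∂((volume.restrict (Ioo 0 T)).prod volume)|
      ≤ ∫ z, ‖b z - v z.1 z.2‖ * (P * (T + 2) * Real.exp (∫ r in z.1..T + 1, ℓ r)) * |u z|
          ∂((volume.restrict (Ioo 0 T)).prod volume) := by
  set μ : Measure (ℝ × E) := (volume.restrict (Ioo 0 T)).prod volume with hμ
  set Λ : ℝ → ℝ := fun t => P * (T + 2) * Real.exp (∫ r in t..T + 1, ℓ r) with hΛ
  have hvm : Continuous fun z : ℝ × E => v z.1 z.2 :=
    continuous_prod_of_continuous_lipschitzWith' (fun z : ℝ × E => v z.1 z.2) K hvL hvc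
  have hΛc : Continuous Λ := by
    have h1 : Continuous fun t => ∫ r in t..T + 1, ℓ r := by
      simp_rw [intervalIntegral.integral_symm (T + 1)]
      exact (intervalIntegral.continuous_primitive
        (fun a b => hℓ.intervalIntegrable a b) _).neg
    fun_prop
  have hΛ0 : ∀ t, 0 ≤ Λ t := fun t => by positivity
  have hmem : ∀ᵐ z ∂μ, z.1 ∈ Ioo 0 T := by
    have h := ae_restrict_mem (μ := (volume : Measure ℝ)) (measurableSet_Ioo (a := 0) (b := T))
    exact Measure.quasiMeasurePreserving_fst.ae h
  have hN : 0 ≤ N := (norm_nonneg _).trans (hbN (0, 0))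
  have hbv : ∀ z : ℝ × E, ‖b z - v z.1 z.2‖ ≤ N + M := fun z =>
    (norm_sub_le _ _).trans (add_le_add (hbN z) (hM _ _))
  have hdm : Measurable fun z : ℝ × E => ‖b z - v z.1 z.2‖ := (hb.sub hvm.measurable).norm
  obtain ⟨A, hA⟩ : ∃ A, ∀ t ∈ Icc 0 T, Λ t ≤ A :=
    (isCompact_Icc.bddAbove_image hΛc.continuousOn).imp fun A hA t ht => hA ⟨t, ht, rfl⟩
  have hI1 : Integrable (fun z => ‖b z - v z.1 z.2‖ * Λ z.1 * |u z|) μ := by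
    refine hu.abs.bdd_mul (c := (N + M) * A)
      (hdm.mul (hΛc.measurable.comp measurable_fst)).aestronglyMeasurable ?_
    filter_upwards [hmem] with z hz
    rw [Real.norm_of_nonneg (mul_nonneg (norm_nonneg _) (hΛ0 _))]
    exact mul_le_mul (hbv z) (hA _ (Ioo_subset_Icc_self hz)) (hΛ0 _) (by positivity)
  refine le_of_forall_pos_le_add fun ε hε => ?_
  set I := ∫ z, |u z| ∂μ with hI
  have hI0 : 0 ≤ I := integral_nonneg fun z => abs_nonneg _
  obtain ⟨κ, hκ0, hκ⟩ : ∃ κ > 0, κ * ((1 + (N + M)) * I) ≤ ε := by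
    refine ⟨ε / ((1 + (N + M)) * I + 1), by positivity, ?_⟩
    rw [div_mul_eq_mul_div, div_le_iff₀ (by positivity)]
    nlinarith
  obtain ⟨φ, hφC, hφK, hφs, hφ⟩ := exists_testFunction_of_transport hT hvL hvc hM hℓ hℓ0 hv hG
    hG0 hGm hvG hψ hP hψL hψQ hT₀ hψT hRR' hψR hR' hκ0
  have hIψ : Integrable (fun z => ψ z * u z) μ :=
    hu.bdd_mul (c := Q) hψ.measurable.aestronglyMeasurable (Eventually.of_forall hψQ)
  have hfd : Continuous (fderiv ℝ φ) := hφC.continuous_fderiv (by simp)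
  obtain ⟨D, hD⟩ := hφC.exists_norm_fderiv_le hφK
  have hIφ : Integrable (fun z => fderiv ℝ φ z (1, b z) * u z) μ := by
    refine hu.bdd_mul (c := D * (1 + N)) ?_ (Eventually.of_forall fun z => ?_)
    · have hc : Continuous fun q : (ℝ × E) × ℝ × E => fderiv ℝ φ q.1 q.2 :=
        (hfd.comp continuous_fst).clm_apply continuous_snd
      exact (hc.measurable.comp
        (measurable_id.prodMk (measurable_const.prodMk hb))).aestronglyMeasurable
    · refine ((fderiv ℝ φ z).le_opNorm _).trans ?_
      refine mul_le_mul (hD z) ?_ (norm_nonneg _) ((norm_nonneg _).trans (hD z))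
      rw [Prod.norm_def]
      simp only [norm_one]
      exact max_le (by linarith) ((hbN z).trans (by linarith))
  have h1 : ∫ z, ψ z * u z ∂μ = ∫ z, (ψ z * u z - fderiv ℝ φ z (1, b z) * u z) ∂μ := by
    rw [integral_sub hIψ hIφ, hweak φ hφC hφK hφs, sub_zero]
  have h2 : ∀ᵐ z ∂μ, ‖ψ z * u z - fderiv ℝ φ z (1, b z) * u z‖
      ≤ ‖b z - v z.1 z.2‖ * Λ z.1 * |u z| + κ * (1 + (N + M)) * |u z| := by
    filter_upwards [hmem] with z hz
    obtain ⟨e1, e2⟩ := hφ z.1 hz z.2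
    have e3 := e2 (b z - v z.1 z.2)
    have e4 : fderiv ℝ φ z (1, b z)
        = fderiv ℝ φ z (1, v z.1 z.2) + fderiv ℝ φ z (0, b z - v z.1 z.2) := by
      rw [← map_add]; simp
    rw [← sub_mul, norm_mul, Real.norm_eq_abs, Real.norm_eq_abs, e4, ← add_mul]
    gcongr
    simp only [Prod.mk.eta] at e1 e3
    rw [abs_le] at e1 e3
    change -((Λ z.1 + κ) * _) ≤ _ ∧ _ ≤ (Λ z.1 + κ) * _ at e3
    have e5 := mul_le_mul_of_nonneg_left (hbv z) hκ0.le
    rw [abs_le]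
    constructor <;> nlinarith [e1.1, e1.2, e3.1, e3.2]
  rw [h1, ← Real.norm_eq_abs]
  refine (norm_integral_le_of_norm_le (hI1.add (hu.abs.const_mul _)) h2).trans ?_
  rw [integral_add' hI1 (hu.abs.const_mul _), integral_const_mul, ← hI]
  gcongr
  linarith

end Duality

/-! ### Fields that are only measurable in time. -/

section TimeMollification

theorem LocallyIntegrable.of_norm_le {F V : Type*} [NormedAddCommGroup F] [MeasurableSpace F]
    [NormedAddCommGroup V] {μ : Measure F} [IsLocallyFiniteMeasure μ] {f : F → V}
    (hf : AEStronglyMeasurable f μ) {C : ℝ} (hC : ∀ z, ‖f z‖ ≤ C) : LocallyIntegrable f μ :=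
  (memLp_top_of_bound hf C (Eventually.of_forall hC)).locallyIntegrable le_top

variable {V : Type*} [NormedAddCommGroup V] [NormedSpace ℝ V]

theorem ContDiffBump.integrable_normed_smul {F : Type*} [NormedAddCommGroup F]
    [NormedSpace ℝ F] [FiniteDimensional ℝ F] [MeasurableSpace F] [BorelSpace F] {μ : Measure F}
    [μ.IsAddHaarMeasure] (ρ : ContDiffBump (0 : F)) {f : F → V} (hf : AEStronglyMeasurable f μ)
    {C : ℝ} (hC : ∀ z, ‖f z‖ ≤ C) : Integrable (fun z => ρ.normed μ z • f z) μ := by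
  have := (LocallyIntegrable.of_norm_le hf hC).integrable_smul_left_of_hasCompactSupport
    (ρ.continuous_normed (μ := μ)) ρ.hasCompactSupport_normed
  exact this

theorem ContDiffBump.norm_integral_normed_smul_le {F : Type*} [NormedAddCommGroup F]
    [NormedSpace ℝ F] [FiniteDimensional ℝ F] [MeasurableSpace F] [BorelSpace F] {μ : Measure F}
    [μ.IsAddHaarMeasure] (ρ : ContDiffBump (0 : F)) {f : F → V} {g : F → ℝ}
    (hg : AEStronglyMeasurable g μ) {C : ℝ} (hC : ∀ z, ‖g z‖ ≤ C) (hfg : ∀ z, ‖f z‖ ≤ g z) :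
    ‖∫ z, ρ.normed μ z • f z ∂μ‖ ≤ ∫ z, ρ.normed μ z • g z ∂μ := by
  refine norm_integral_le_of_norm_le (ρ.integrable_normed_smul hg hC)
    (Eventually.of_forall fun z => ?_)
  rw [norm_smul, Real.norm_of_nonneg (ρ.nonneg_normed z)]
  exact mul_le_mul_of_nonneg_left (hfg z) (ρ.nonneg_normed z)

theorem ContDiffBump.norm_integral_normed_smul_le_const {F : Type*} [NormedAddCommGroup F]
    [NormedSpace ℝ F] [FiniteDimensional ℝ F] [MeasurableSpace F] [BorelSpace F] {μ : Measure F}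
    [μ.IsAddHaarMeasure] (ρ : ContDiffBump (0 : F)) {f : F → V} {C : ℝ} (hC : ∀ z, ‖f z‖ ≤ C) :
    ‖∫ z, ρ.normed μ z • f z ∂μ‖ ≤ C := by
  have := ρ.norm_integral_normed_smul_le (μ := μ) (f := f) (g := fun _ => C)
    aestronglyMeasurable_const (C := |C|) (fun _ => le_rfl) hC
  rwa [integral_smul_const, ρ.integral_normed, one_smul] at this

theorem tendsto_of_forall_dense_of_lipschitz {X Y : Type*} [PseudoMetricSpace X]
    [PseudoMetricSpace Y] {D : Set X} (hD : Dense D) {K : ℝ≥0} {f : ℕ → X → Y} {g : X → Y}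
    (hf : ∀ j, LipschitzWith K (f j)) (hg : LipschitzWith K g)
    (h : ∀ x ∈ D, Tendsto (fun j => f j x) atTop (𝓝 (g x))) (x : X) :
    Tendsto (fun j => f j x) atTop (𝓝 (g x)) := by
  refine Metric.tendsto_atTop.2 fun ε hε => ?_
  obtain ⟨y, hy, hyx⟩ := hD.exists_dist_lt x (ε := ε / (4 * (K + 1))) (by positivity)
  obtain ⟨j₀, hj₀⟩ := Metric.tendsto_atTop.1 (h y hy) (ε / 2) (by linarith)
  refine ⟨j₀, fun j hj => ?_⟩
  have h1 := (hf j).dist_le_mul x y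
  have h2 := hg.dist_le_mul y x
  rw [dist_comm y x] at h2
  have h3 : K * dist x y ≤ ε / 4 := by
    have : (K + 1) * dist x y ≤ (K + 1) * (ε / (4 * (K + 1))) := by gcongr
    have h4 : (K + 1 : ℝ) * (ε / (4 * (K + 1))) = ε / 4 := by
      have : (K + 1 : ℝ) ≠ 0 := by positivity
      field_simp
    nlinarith [dist_nonneg (x := x) (y := y)]
  calc dist (f j x) (g x) ≤ dist (f j x) (f j y) + dist (f j y) (g y) + dist (g y) (g x) :=
        dist_triangle4 _ _ _ _
    _ < ε := by linarith [hj₀ j hj]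

variable {E : Type*} [NormedAddCommGroup E] [InnerProductSpace ℝ E] [FiniteDimensional ℝ E]
  [MeasureSpace E] [BorelSpace E] [(volume : Measure E).IsAddHaarMeasure]

theorem continuous_mul_exp_integral {ℓ : ℝ → ℝ} (hℓ : ∀ a b, IntervalIntegrable ℓ volume a b)
    (P T : ℝ) : Continuous fun t => P * Real.exp (∫ r in t..T, ℓ r) := by
  have h1 : Continuous fun t => ∫ r in t..T, ℓ r := by
    simp_rw [intervalIntegral.integral_symm T]
    exact (intervalIntegral.continuous_primitive hℓ _).neg
  fun_prop

/-- Convolve `B` and its rate `L` in time with the same kernel: the Lipschitz, sup and growth bounds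
all persist. The previous estimate then passes to the limit by Lebesgue differentiation and
dominated convergence. -/
theorem abs_integral_mul_le_of_measurable_transport {T : ℝ} (hT : 0 < T)
    {B : ℝ → E → E} {L G : ℝ → ℝ} {K M : ℝ≥0}
    (hBL : ∀ t, LipschitzWith K (B t)) (hBm : ∀ x, Measurable fun t => B t x)
    (hM : ∀ t x, ‖B t x‖ ≤ M) (hL : Measurable L) (hL0 : ∀ s, 0 ≤ L s) (hLK : ∀ s, L s ≤ K)
    (hB : ∀ s x y, ‖B s x - B s y‖ ≤ L s * ‖x - y‖)
    (hG : Continuous G) (hG0 : ∀ s, 0 < G s) (hGm : MonotoneOn G (Ici 0))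
    (hBG : ∀ t x, ‖B t x‖ ≤ G ‖x‖)
    {ψ : ℝ × E → ℝ} (hψ : Continuous ψ) {P Q : ℝ} (hP : 0 ≤ P)
    (hψL : ∀ t x y, |ψ (t, x) - ψ (t, y)| ≤ P * ‖x - y‖) (hψQ : ∀ z, |ψ z| ≤ Q)
    {T₀ : ℝ} (hT₀ : T₀ < T) (hψT : ∀ t x, T₀ ≤ t → ψ (t, x) = 0)
    {R R' : ℝ} (hRR' : R ≤ R') (hψR : ∀ t x, R < ‖x‖ → ψ (t, x) = 0)
    (hR' : (∫ r in 0..√(1 + R ^ 2), (G r)⁻¹) + (T + 2) < ∫ r in 0..R', (G r)⁻¹)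
    {b : ℝ × E → E} (hb : Measurable b) {N : ℝ} (hbN : ∀ z, ‖b z‖ ≤ N)
    {u : ℝ × E → ℝ} (hu : Integrable u ((volume.restrict (Ioo 0 T)).prod volume))
    (hweak : ∀ φ : ℝ × E → ℝ, ContDiff ℝ ∞ φ → HasCompactSupport φ →
      tsupport φ ⊆ Iio T ×ˢ Metric.ball 0 (R' + 1) →
      ∫ z, fderiv ℝ φ z (1, b z) * u z ∂((volume.restrict (Ioo 0 T)).prod volume) = 0) :
    |∫ z, ψ z * u z ∂((volume.restrict (Ioo 0 T)).prod volume)|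
      ≤ ∫ z, ‖b z - B z.1 z.2‖ * (P * (T + 2) * Real.exp (∫ r in z.1..T + 1, L r)) * |u z|
          ∂((volume.restrict (Ioo 0 T)).prod volume) := by
  set μ : Measure (ℝ × E) := (volume.restrict (Ioo 0 T)).prod volume with hμ
  set ρ : ℕ → ContDiffBump (0 : ℝ) := fun j =>
    ⟨1 / (j + 1) / 2, 1 / (j + 1), by positivity, half_lt_self (by positivity)⟩ with hρ
  have hLK' : ∀ s, ‖L s‖ ≤ K := fun s => by rw [Real.norm_of_nonneg (hL0 s)]; exact hLK s
  set ℓ : ℕ → ℝ → ℝ := fun j =>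
    (ρ j).normed volume ⋆[ContinuousLinearMap.lsmul ℝ ℝ, volume] L with hℓ
  set v : ℕ → ℝ → E → E := fun j t x =>
    ((ρ j).normed volume ⋆[ContinuousLinearMap.lsmul ℝ ℝ, volume] fun s => B s x) t with hv
  have hBx : ∀ x t, AEStronglyMeasurable (fun s => B (t - s) x) volume := fun x t =>
    ((hBm x).comp (measurable_const.sub measurable_id)).aestronglyMeasurable
  have hLt : ∀ t, AEStronglyMeasurable (fun s => L (t - s)) volume := fun t =>
    (hL.comp (measurable_const.sub measurable_id)).aestronglyMeasurable
  have hℓdef : ∀ j t, ℓ j t = ∫ s, (ρ j).normed volume s • L (t - s) := fun j t => rfl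
  have hvdef : ∀ j t x, v j t x = ∫ s, (ρ j).normed volume s • B (t - s) x := fun j t x => rfl
  have hℓloc : LocallyIntegrable L volume :=
    LocallyIntegrable.of_norm_le hL.aestronglyMeasurable hLK'
  have hvloc : ∀ x, LocallyIntegrable (fun s => B s x) volume := fun x =>
    LocallyIntegrable.of_norm_le (hBm x).aestronglyMeasurable fun s => hM s x
  have hℓc : ∀ j, Continuous (ℓ j) := fun j =>
    ((ρ j).hasCompactSupport_normed.contDiff_convolution_left (n := 0) _ (ρ j).contDiff_normed
      hℓloc).continuous
  have hvc : ∀ j x, Continuous fun t => v j t x := fun j x =>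
    ((ρ j).hasCompactSupport_normed.contDiff_convolution_left (n := 0) _ (ρ j).contDiff_normed
      (hvloc x)).continuous
  have hℓ0 : ∀ j t, 0 ≤ ℓ j t := fun j t =>
    integral_nonneg fun s => mul_nonneg ((ρ j).nonneg_normed s) (hL0 _)
  have hℓK : ∀ j t, ℓ j t ≤ K := fun j t =>
    (le_abs_self _).trans ((ρ j).norm_integral_normed_smul_le_const fun s => hLK' (t - s))
  have hvℓ : ∀ j s x y, ‖v j s x - v j s y‖ ≤ ℓ j s * ‖x - y‖ := by
    intro j s x y
    rw [hvdef, hvdef, ← integral_sub ((ρ j).integrable_normed_smul (hBx x s) fun r => hM _ x)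
      ((ρ j).integrable_normed_smul (hBx y s) fun r => hM _ y)]
    simp_rw [← smul_sub]
    refine ((ρ j).norm_integral_normed_smul_le ((hLt s).mul_const ‖x - y‖)
      (C := K * ‖x - y‖) (fun r => ?_) fun r => hB (s - r) x y).trans_eq ?_
    · rw [norm_mul, norm_norm]
      exact mul_le_mul_of_nonneg_right (hLK' _) (norm_nonneg _)
    · rw [hℓdef, ← integral_mul_const]
      simp only [smul_eq_mul, mul_assoc]
  have hvL : ∀ j t, LipschitzWith K (v j t) := fun j t =>
    LipschitzWith.of_dist_le_mul fun x y => by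
      rw [dist_eq_norm, dist_eq_norm]
      exact (hvℓ j t x y).trans (mul_le_mul_of_nonneg_right (hℓK j t) (norm_nonneg _))
  have hvM : ∀ j t x, ‖v j t x‖ ≤ M := fun j t x =>
    (ρ j).norm_integral_normed_smul_le_const fun s => hM _ _
  have hvG : ∀ j t x, ‖v j t x‖ ≤ G ‖x‖ := fun j t x =>
    (ρ j).norm_integral_normed_smul_le_const fun s => hBG _ _
  have hρ0 : Tendsto (fun j => (ρ j).rOut) atTop (𝓝 0) := tendsto_one_div_add_atTop_nhds_zero_nat
  have hρ2 : ∀ᶠ j in atTop, (ρ j).rOut ≤ 2 * (ρ j).rIn := Eventually.of_forall fun j => by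
    simp only [hρ]; linarith
  have hℓlim : ∀ᵐ t, Tendsto (fun j => ℓ j t) atTop (𝓝 (L t)) :=
    ContDiffBump.ae_convolution_tendsto_right_of_locallyIntegrable hρ0 hρ2 hℓloc
  -- One null set of times serves all `x`: convergence on a countable dense set extends by the
  -- common Lipschitz constant.
  have hvlim : ∀ᵐ t, ∀ x, Tendsto (fun j => v j t x) atTop (𝓝 (B t x)) := by
    have h1 : ∀ᵐ t, ∀ i : ℕ, Tendsto (fun j => v j t (TopologicalSpace.denseSeq E i)) atTop
        (𝓝 (B t (TopologicalSpace.denseSeq E i))) := ae_all_iff.2 fun i =>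
      ContDiffBump.ae_convolution_tendsto_right_of_locallyIntegrable hρ0 hρ2 (hvloc _)
    filter_upwards [h1] with t ht
    refine tendsto_of_forall_dense_of_lipschitz (TopologicalSpace.denseRange_denseSeq E)
      (fun j => hvL j t) (hBL t) ?_
    rintro _ ⟨i, rfl⟩
    exact ht i
  have hΛlim : ∀ t, Tendsto (fun j => ∫ r in t..T + 1, ℓ j r) atTop
      (𝓝 (∫ r in t..T + 1, L r)) := fun t =>
    intervalIntegral.tendsto_integral_filter_of_dominated_convergence (fun _ => (K : ℝ))
      (Eventually.of_forall fun j => (hℓc j).aestronglyMeasurable)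
      (Eventually.of_forall fun j => Eventually.of_forall fun s _ => by
        rw [Real.norm_of_nonneg (hℓ0 j s)]; exact hℓK j s)
      intervalIntegrable_const (hℓlim.mono fun s hs _ => hs)
  have hmem : ∀ᵐ z ∂μ, z.1 ∈ Ioo 0 T := by
    have h := ae_restrict_mem (μ := (volume : Measure ℝ)) (measurableSet_Ioo (a := 0) (b := T))
    exact Measure.quasiMeasurePreserving_fst.ae h
  have hlim : ∀ᵐ z ∂μ, ∀ x, Tendsto (fun j => v j z.1 x) atTop (𝓝 (B z.1 x)) :=
    Measure.quasiMeasurePreserving_fst.ae (ae_restrict_of_ae hvlim)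
  have hN : 0 ≤ N := (norm_nonneg _).trans (hbN (0, 0))
  refine le_of_tendsto_of_tendsto' tendsto_const_nhds
    (tendsto_integral_of_dominated_convergence
      (F := fun j z => ‖b z - v j z.1 z.2‖
        * (P * (T + 2) * Real.exp (∫ r in z.1..T + 1, ℓ j r)) * |u z|)
      (fun z => (N + M) * (P * (T + 2) * Real.exp (K * (T + 1))) * |u z|) ?_
      (hu.abs.const_mul _) ?_ ?_)
    fun j => abs_integral_mul_le_of_transport hT (hvL j) (hvc j) (hvM j) (hℓc j) (hℓ0 j)
      (hvℓ j) hG hG0 hGm (hvG j) hψ hP hψL hψQ hT₀ hψT hRR' hψR hR' hb hbN hu hweak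
  · intro j
    have hvm : Continuous fun z : ℝ × E => v j z.1 z.2 :=
      continuous_prod_of_continuous_lipschitzWith' (fun z : ℝ × E => v j z.1 z.2) K (hvL j) (hvc j)
    have hΛ := (continuous_mul_exp_integral (fun a b => (hℓc j).intervalIntegrable a b)
      (P * (T + 2)) (T + 1)).measurable
    exact ((((hb.sub hvm.measurable).norm).mul (hΛ.comp measurable_fst)).aestronglyMeasurable).mul
      hu.abs.aestronglyMeasurable
  · intro j
    filter_upwards [hmem] with z hz
    rw [norm_mul, Real.norm_eq_abs |u z|, abs_abs, norm_mul, norm_norm,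
      Real.norm_of_nonneg (by positivity)]
    gcongr
    · exact (norm_sub_le _ _).trans (add_le_add (hbN z) (hvM j _ _))
    · have h1 := intervalIntegral.norm_integral_le_of_norm_le_const (a := z.1) (b := T + 1)
        (f := ℓ j) (C := K) fun r _ => by rw [Real.norm_of_nonneg (hℓ0 j r)]; exact hℓK j r
      refine (le_abs_self _).trans (h1.trans ?_)
      gcongr
      rw [abs_le]
      constructor <;> linarith [hz.1, hz.2]
  · filter_upwards [hlim] with z hz
    exact (((tendsto_const_nhds.sub (hz z.2)).norm).mul
      (((Real.continuous_exp.tendsto _).comp (hΛlim z.1)).const_mul _)).mul_const _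

end TimeMollification

/-! ### Spatial mollification at a time-dependent scale. -/

section SpaceMollification

/-- Subdivide the segment into steps shorter than `r`. This lets the Lipschitz estimate below use
the modulus at `ε` alone, without concavity or doubling of `w`. -/
theorem norm_sub_le_mul_of_forall_norm_sub_le {F V : Type*} [NormedAddCommGroup F]
    [NormedSpace ℝ F] [NormedAddCommGroup V] {f : F → V} {r C : ℝ} (hr : 0 < r)
    (h : ∀ x y, ‖x - y‖ ≤ r → ‖f x - f y‖ ≤ C * ‖x - y‖) (x y : F) :
    ‖f x - f y‖ ≤ C * ‖x - y‖ := by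
  obtain ⟨N, hN⟩ := exists_nat_gt (‖x - y‖ / r)
  have hN0 : (0 : ℝ) < N := (by positivity : 0 ≤ ‖x - y‖ / r).trans_lt hN
  have hstep : ‖((N : ℝ)⁻¹) • (x - y)‖ = (N : ℝ)⁻¹ * ‖x - y‖ := by
    rw [norm_smul, Real.norm_of_nonneg (by positivity)]
  have hd := dist_le_range_sum_of_dist_le (f := fun i : ℕ => f (y + ((i : ℝ) / N) • (x - y))) N
    (d := fun _ => C * ((N : ℝ)⁻¹ * ‖x - y‖)) fun {k} _ => by
      have e : y + ((k : ℝ) / N) • (x - y) - (y + (((k + 1 : ℕ) : ℝ) / N) • (x - y))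
          = -((N : ℝ)⁻¹ • (x - y)) := by
        rw [add_sub_add_left_eq_sub, ← sub_smul, ← neg_smul]
        congr 1
        push_cast
        field_simp
        ring
      rw [dist_eq_norm]
      have := h (y + ((k : ℝ) / N) • (x - y)) (y + (((k + 1 : ℕ) : ℝ) / N) • (x - y))
      rw [e, norm_neg, hstep] at this
      refine this ?_
      rw [div_lt_iff₀ hr] at hN
      rw [inv_mul_le_iff₀ hN0]
      exact hN.le
  simp only [Nat.cast_zero, zero_div, zero_smul, add_zero, div_self hN0.ne', one_smul,
    add_sub_cancel, Finset.sum_const, Finset.card_range, nsmul_eq_mul, dist_eq_norm] at hd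
  rw [norm_sub_rev]
  refine hd.trans_eq ?_
  field_simp

variable {E : Type*} [NormedAddCommGroup E] [InnerProductSpace ℝ E] [FiniteDimensional ℝ E]
  [MeasureSpace E] [BorelSpace E] [(volume : Measure E).IsAddHaarMeasure]

/-- The mollification of `f` at scale `ε`, by the kernel `η`. -/
noncomputable def ContDiffBump.mollify (η : ContDiffBump (0 : E)) (f : E → E) (ε : ℝ) (x : E) : E :=
  ∫ y, η.normed volume y • f (x - ε • y)

theorem ContDiffBump.norm_mollify_sub_le (η : ContDiffBump (0 : E)) (hη : η.rOut ≤ 1)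
    {f : E → E} {w : ℝ → ℝ} (hw : MonotoneOn w (Ici 0)) (hfw : ∀ x y, ‖f x - f y‖ ≤ w ‖x - y‖)
    {ε : ℝ} (hε : 0 ≤ ε) (x : E)
    (hI : Integrable (fun y => η.normed volume y • f (x - ε • y)) volume) :
    ‖η.mollify f ε x - f x‖ ≤ w ε := by
  have hη1 : Integrable (fun y => η.normed volume y) volume :=
    integrable_of_integral_eq_one η.integral_normed
  have h1 : η.mollify f ε x - f x = ∫ y, η.normed volume y • (f (x - ε • y) - f x) := by
    simp_rw [smul_sub]
    rw [integral_sub hI (hη1.smul_const _), integral_smul_const, η.integral_normed, one_smul]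
    rfl
  rw [h1]
  refine (norm_integral_le_of_norm_le (hη1.mul_const (w ε))
    (Eventually.of_forall fun y => ?_)).trans_eq ?_
  · rw [norm_smul, Real.norm_of_nonneg (η.nonneg_normed y)]
    by_cases hy : y ∈ Metric.ball (0 : E) η.rOut
    · refine mul_le_mul_of_nonneg_left ((hfw _ _).trans ?_) (η.nonneg_normed y)
      rw [mem_ball_zero_iff] at hy
      refine hw (mem_Ici.2 (norm_nonneg _)) hε ?_
      rw [sub_sub_cancel_left, norm_neg, norm_smul, Real.norm_of_nonneg hε]
      nlinarith [norm_nonneg y]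
    · rw [← η.support_normed_eq (μ := volume), Function.notMem_support] at hy
      simp [hy]
  · rw [integral_mul_const, η.integral_normed, one_mul]

variable (E) in
-- Translating the argument by `ε • h` translates the kernel by `h`, which changes it by at most `K
-- * ‖h‖`. The change has zero mean, so it only sees the oscillation of `f` at scale `ε`. The `+ 1`
-- in the constant merely makes it positive.
theorem exists_mollify_lipschitz : ∃ (η : ContDiffBump (0 : E)) (c : ℝ), η.rOut ≤ 1 ∧ 0 < c ∧
    ∀ (f : E → E), Measurable f → ∀ M : ℝ, (∀ x, ‖f x‖ ≤ M) → ∀ w : ℝ → ℝ,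
      MonotoneOn w (Ici 0) → (∀ x y, ‖f x - f y‖ ≤ w ‖x - y‖) → ∀ ε : ℝ, 0 < ε → ∀ x y,
        ‖η.mollify f ε x - η.mollify f ε y‖ ≤ c * w ε / ε * ‖x - y‖ := by
  set η : ContDiffBump (0 : E) := ⟨1 / 4, 1 / 2, by norm_num, by norm_num⟩
  have hη : η.rOut = 1 / 2 := rfl
  obtain ⟨K, hK⟩ : ∃ K, LipschitzWith K (η.normed (volume : Measure E)) :=
    ContDiff.lipschitzWith_of_hasCompactSupport η.hasCompactSupport_normed
      (η.contDiff_normed (n := 1)) one_ne_zero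
  set A : ℝ := (volume : Measure E).real (Metric.closedBall (0 : E) 1)
  refine ⟨η, K * A + 1, by norm_num [hη], by positivity, ?_⟩
  intro f hf M hM w hw hfw ε hε
  have hw0 : 0 ≤ w ε := by
    have h0 := (norm_nonneg _).trans (hfw 0 0)
    simp only [sub_self, norm_zero] at h0
    exact h0.trans (hw (mem_Ici.2 le_rfl) (mem_Ici.2 hε.le) hε.le)
  -- With `‖h‖ ≤ 1/2` and kernel radius `1/2`, both kernels live in the unit ball, so only `w ε`
  -- enters.
  refine norm_sub_le_mul_of_forall_norm_sub_le (r := ε / 2) (by linarith) fun x' x hx => ?_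
  set h : E := ε⁻¹ • (x' - x) with hh
  have hx' : x' = x + ε • h := by rw [hh, smul_inv_smul₀ hε.ne']; abel
  have hhn : ‖x' - x‖ = ε * ‖h‖ := by
    rw [hx', add_sub_cancel_left, norm_smul, Real.norm_of_nonneg hε.le]
  have hh2 : ‖h‖ ≤ 1 / 2 := by
    rw [hhn] at hx
    by_contra! hc
    nlinarith
  have hη1 : Integrable (fun y => η.normed volume y) volume :=
    integrable_of_integral_eq_one η.integral_normed
  have hI : ∀ x, Integrable (fun y => η.normed volume y • f (x - ε • y)) volume := fun x =>
    η.integrable_normed_smul (hf.comp (by fun_prop)).aestronglyMeasurable fun y => hM _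
  have hsh : ∀ y, η.normed volume (y + h) • f (x + ε • h - ε • (y + h))
      = η.normed volume (y + h) • f (x - ε • y) := fun y => by
    rw [smul_add]; congr 2; abel
  have hI' : Integrable (fun y => η.normed volume (y + h) • f (x - ε • y)) volume := by
    simpa only [hsh] using (hI (x + ε • h)).comp_add_right h
  have e1 : η.mollify f ε x' = ∫ y, η.normed volume (y + h) • f (x - ε • y) := by
    rw [hx', ContDiffBump.mollify, ← integral_add_right_eq_self _ h]
    simp only [hsh]
  have e2 : ∫ y, (η.normed volume (y + h) - η.normed volume y) • f x = 0 := by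
    rw [integral_smul_const, integral_sub (hη1.comp_add_right h) hη1,
      integral_add_right_eq_self, sub_self, zero_smul]
  have hη2 : Integrable (fun y => (η.normed volume (y + h) - η.normed volume y) • f x) volume :=
    ((hη1.comp_add_right h).sub hη1).smul_const _
  have e3 : η.mollify f ε x' - η.mollify f ε x
      = ∫ y, (η.normed volume (y + h) - η.normed volume y) • (f (x - ε • y) - f x) := by
    simp_rw [smul_sub]
    rw [integral_sub _ hη2, e2, sub_zero, e1,
      ContDiffBump.mollify, ← integral_sub hI' (hI x)]
    · simp_rw [sub_smul]
    · simp_rw [sub_smul]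
      exact hI'.sub (hI x)
  rw [e3]
  have hsupp : ∀ y : E, 1 / 2 ≤ ‖y‖ → η.normed volume y = 0 := fun y hy => by
    have : y ∉ Function.support (η.normed (volume : Measure E)) := by
      rw [η.support_normed_eq, mem_ball_zero_iff, hη]; exact not_lt.2 hy
    exact Function.notMem_support.1 this
  have hbound : ∀ y, ‖(η.normed volume (y + h) - η.normed volume y) • (f (x - ε • y) - f x)‖
      ≤ (Metric.closedBall (0 : E) 1).indicator (fun _ => K * ‖h‖ * w ε) y := by
    intro y
    by_cases hy : ‖y‖ ≤ 1
    · rw [indicator_of_mem (by simpa using hy), norm_smul]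
      have h1 : ‖η.normed volume (y + h) - η.normed volume y‖ ≤ K * ‖h‖ := by
        simpa [dist_eq_norm] using hK.dist_le_mul (y + h) y
      refine mul_le_mul h1 ((hfw _ _).trans (hw (mem_Ici.2 (norm_nonneg _)) hε.le ?_))
        (norm_nonneg _) (by positivity)
      rw [sub_sub_cancel_left, norm_neg, norm_smul, Real.norm_of_nonneg hε.le]
      nlinarith
    · push Not at hy
      have h1 : 1 / 2 ≤ ‖y + h‖ := by
        have := norm_sub_le (y + h) h
        rw [add_sub_cancel_right] at this
        linarith
      rw [hsupp _ h1, hsupp y (by linarith)]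
      simp only [sub_self, zero_smul, norm_zero]
      exact indicator_nonneg (fun _ _ => by positivity) _
  refine (norm_integral_le_of_norm_le ?_ (Eventually.of_forall hbound)).trans ?_
  · exact IntegrableOn.integrable_indicator
      (integrableOn_const (isCompact_closedBall _ _).measure_ne_top) measurableSet_closedBall
  · rw [integral_indicator_const _ measurableSet_closedBall, smul_eq_mul, hhn]
    have : (K * A + 1) * w ε / ε * (ε * ‖h‖) = A * (K * ‖h‖ * w ε) + w ε * ‖h‖ := by
      field_simp
    rw [this]
    have : 0 ≤ w ε * ‖h‖ := by positivity
    linarith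

variable (E) in
-- Mollifying `b (t, ·)` at scale `ε t` gives error `w (ε t)` and Lipschitz rate `c * (w (ε t) / ε
-- t)`. The constant `c` precedes all data, so the schedule `ε` may be chosen knowing it. The term
-- `w ε₁` in the growth hypothesis pays for the mollified field.
theorem exists_abs_integral_mul_le_of_modulus : ∃ c : ℝ, 0 < c ∧
    ∀ {T : ℝ} (_ : 0 < T) {b : ℝ × E → E} (_ : Measurable b) {N : ℝ} (_ : ∀ z, ‖b z‖ ≤ N)
    (_ : ∀ t ∉ Ioo 0 T, ∀ x, b (t, x) = 0)
    {w : ℝ → ℝ} (_ : MonotoneOn w (Ici 0))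
    (_ : ∀ t x y, ‖b (t, x) - b (t, y)‖ ≤ w ‖x - y‖)
    {G : ℝ → ℝ} (_ : Continuous G) (_ : ∀ s, 0 < G s) (_ : MonotoneOn G (Ici 0))
    {ε₁ : ℝ} (_ : ∀ t x, ‖b (t, x)‖ + w ε₁ ≤ G ‖x‖)
    {ψ : ℝ × E → ℝ} (_ : Continuous ψ) {P Q : ℝ} (_ : 0 ≤ P)
    (_ : ∀ t x y, |ψ (t, x) - ψ (t, y)| ≤ P * ‖x - y‖) (_ : ∀ z, |ψ z| ≤ Q)
    {T₀ : ℝ} (_ : T₀ < T) (_ : ∀ t x, T₀ ≤ t → ψ (t, x) = 0)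
    {R R' : ℝ} (_ : R ≤ R') (_ : ∀ t x, R < ‖x‖ → ψ (t, x) = 0)
    (_ : (∫ r in 0..√(1 + R ^ 2), (G r)⁻¹) + (T + 2) < ∫ r in 0..R', (G r)⁻¹)
    {u : ℝ × E → ℝ} (_ : Integrable u ((volume.restrict (Ioo 0 T)).prod volume))
    (_ : ∀ φ : ℝ × E → ℝ, ContDiff ℝ ∞ φ → HasCompactSupport φ →
      tsupport φ ⊆ Iio T ×ˢ Metric.ball 0 (R' + 1) →
      ∫ z, fderiv ℝ φ z (1, b z) * u z ∂((volume.restrict (Ioo 0 T)).prod volume) = 0)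
    {ε : ℝ → ℝ} (_ : Measurable ε) (_ : Measurable fun t => w (ε t)) {ε₀ : ℝ} (_ : 0 < ε₀)
    (_ : ∀ t, ε₀ ≤ ε t) (_ : ∀ t, ε t ≤ ε₁),
    |∫ z, ψ z * u z ∂((volume.restrict (Ioo 0 T)).prod volume)|
      ≤ P * (T + 2) * ∫ t in Ioo 0 T,
          w (ε t) * Real.exp (∫ r in t..T, c * (w (ε r) / ε r)) * ∫ x, |u (t, x)| := by
  obtain ⟨η, c, hη, hc, hLip⟩ := exists_mollify_lipschitz E
  refine ⟨c, hc, ?_⟩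
  intro T hT b hb N hN hb0 w hw hbw G hG hG0 hGm ε₁ hbG ψ hψ P Q hP hψL hψQ T₀ hT₀ hψT R R' hRR'
    hψR hR' u hu hweak ε hε hwε ε₀ hε₀ hεl hεu
  set μ : Measure (ℝ × E) := (volume.restrict (Ioo 0 T)).prod volume with hμ
  have hεpos : ∀ t, 0 < ε t := fun t => hε₀.trans_le (hεl t)
  have hw0 : ∀ s, 0 ≤ s → 0 ≤ w s := fun s hs => by
    have h0 := (norm_nonneg _).trans (hbw 0 0 0)
    simp only [sub_self, norm_zero] at h0
    exact h0.trans (hw (mem_Ici.2 le_rfl) (mem_Ici.2 hs) hs)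
  have hwu : ∀ t, w (ε t) ≤ w ε₁ := fun t =>
    hw (hεpos t).le ((hεpos t).le.trans (hεu t)) (hεu t)
  have hbt : ∀ t, Measurable fun x => b (t, x) := fun t => hb.comp measurable_prodMk_left
  set B : ℝ → E → E := fun t => η.mollify (fun x => b (t, x)) (ε t) with hBdef
  -- The field vanishes outside `(0, T)`, so the rate may too, and the extra time beyond `T` adds
  -- nothing to the exponent.
  set L : ℝ → ℝ := (Ioo 0 T).indicator fun t => c * (w (ε t) / ε t) with hLdef
  have hN0 : 0 ≤ N := (norm_nonneg _).trans (hN (0, 0))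
  have hwε₁ : 0 ≤ w ε₁ := (hw0 _ (hεpos 0).le).trans (hwu 0)
  set K : ℝ≥0 := (c * (w ε₁ / ε₀)).toNNReal with hK
  have hKc : (K : ℝ) = c * (w ε₁ / ε₀) := Real.coe_toNNReal _ (by positivity)
  have hL0 : ∀ t, 0 ≤ L t := fun t => indicator_nonneg
    (fun t _ => mul_nonneg hc.le (div_nonneg (hw0 _ (hεpos t).le) (hεpos t).le)) t
  have hLK : ∀ t, L t ≤ K := fun t => by
    rw [hKc]
    refine indicator_apply_le' (fun _ => ?_) fun _ => by positivity
    have := hwu t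
    have := hεl t
    gcongr
  have hB : ∀ t x y, ‖B t x - B t y‖ ≤ L t * ‖x - y‖ := by
    intro t x y
    by_cases ht : t ∈ Ioo 0 T
    · simp only [hLdef, indicator_of_mem ht]
      rw [← mul_div_assoc]
      exact hLip _ (hbt t) N (fun x => hN _) w hw (hbw t) (ε t) (hεpos t) x y
    · simp [hBdef, hLdef, indicator_of_notMem ht, ContDiffBump.mollify, hb0 t ht]
  have hBsub : ∀ t x, ‖B t x - b (t, x)‖ ≤ w (ε t) := fun t x =>
    η.norm_mollify_sub_le hη hw (hbw t) (hεpos t).le x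
      (η.integrable_normed_smul ((hbt t).comp (by fun_prop)).aestronglyMeasurable fun y => hN _)
  have hBG : ∀ t x, ‖B t x‖ ≤ G ‖x‖ := fun t x => by
    have h1 := norm_add_le (B t x - b (t, x)) (b (t, x))
    rw [sub_add_cancel] at h1
    linarith [hBsub t x, hbG t x, hwu t]
  have hmain := abs_integral_mul_le_of_measurable_transport hT (B := B) (L := L) (K := K)
    (M := N.toNNReal) (fun t => LipschitzWith.of_dist_le_mul fun x y => by
      rw [dist_eq_norm, dist_eq_norm]
      exact (hB t x y).trans (mul_le_mul_of_nonneg_right (hLK t) (norm_nonneg _)))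
    (fun x => by
      have h1 : Measurable fun q : ℝ × E => η.normed volume q.2 • b (q.1, x - ε q.1 • q.2) := by
        have h2 : Measurable fun q : ℝ × E => η.normed (volume : Measure E) q.2 :=
          (η.continuous_normed (μ := volume)).measurable.comp measurable_snd
        have h3 : Measurable fun q : ℝ × E => b (q.1, x - ε q.1 • q.2) :=
          hb.comp (measurable_fst.prodMk
            (measurable_const.sub ((hε.comp measurable_fst).smul measurable_snd)))
        exact h2.smul h3
      exact (h1.stronglyMeasurable.integral_prod_right (ν := volume)).measurable)
    (fun t x => by
      rw [Real.coe_toNNReal _ hN0]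
      exact η.norm_integral_normed_smul_le_const fun y => hN _)
    ((measurable_const.mul (hwε.div hε)).indicator measurableSet_Ioo) hL0 hLK hB hG hG0 hGm hBG
    hψ hP hψL hψQ hT₀ hψT hRR' hψR hR' hb hN hu hweak
  refine hmain.trans ?_
  have hmem : ∀ᵐ z ∂μ, z.1 ∈ Ioo 0 T := by
    have h := ae_restrict_mem (μ := (volume : Measure ℝ)) (measurableSet_Ioo (a := 0) (b := T))
    exact Measure.quasiMeasurePreserving_fst.ae h
  have hLeq : ∀ t ∈ Ioo 0 T, ∫ r in t..T + 1, L r = ∫ r in t..T, c * (w (ε r) / ε r) := by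
    intro t ht
    rw [intervalIntegral.integral_of_le (by linarith [ht.2]),
      intervalIntegral.integral_of_le ht.2.le, integral_Ioc_eq_integral_Ioo (y := T),
      setIntegral_indicator measurableSet_Ioo]
    congr 2
    ext s
    simp only [mem_inter_iff, mem_Ioc, mem_Ioo]
    constructor
    · rintro ⟨⟨h1, h2⟩, h3, h4⟩; exact ⟨h1, h4⟩
    · rintro ⟨h1, h2⟩; exact ⟨⟨h1, by linarith⟩, by linarith [ht.1], h2⟩
  set g : ℝ → ℝ := fun t => w (ε t) * (P * (T + 2) * Real.exp (∫ r in t..T + 1, L r)) with hg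
  have hLi : ∀ a b, IntervalIntegrable L volume a b := fun a b => by
    refine (intervalIntegrable_const (c := (K : ℝ))).mono_fun
      ((measurable_const.mul (hwε.div hε)).indicator measurableSet_Ioo).aestronglyMeasurable
      (Eventually.of_forall fun t => ?_)
    change ‖L t‖ ≤ ‖(K : ℝ)‖
    rw [Real.norm_of_nonneg (hL0 t), Real.norm_of_nonneg K.coe_nonneg]
    exact hLK t
  have hgm : Measurable g :=
    hwε.mul (continuous_mul_exp_integral hLi _ _).measurable
  have hgi : Integrable (fun z => g z.1 * |u z|) μ := by
    refine hu.abs.bdd_mul (c := w ε₁ * (P * (T + 2) * Real.exp (K * (T + 1))))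
      (hgm.comp measurable_fst).aestronglyMeasurable ?_
    filter_upwards [hmem] with z hz
    have h0 := hw0 _ (hεpos z.1).le
    have h1 := intervalIntegral.norm_integral_le_of_norm_le_const (a := z.1) (b := T + 1)
      (f := L) (C := K) fun r _ => by rw [Real.norm_of_nonneg (hL0 r)]; exact hLK r
    rw [Real.norm_of_nonneg (by simp only [hg]; positivity)]
    simp only [hg]
    have h2 := hwu z.1
    gcongr
    refine (le_abs_self _).trans (h1.trans ?_)
    gcongr
    rw [abs_le]
    constructor <;> linarith [hz.1, hz.2]
  calc _ ≤ ∫ z, g z.1 * |u z| ∂μ := by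
        refine integral_mono_of_nonneg (Eventually.of_forall fun z => by positivity) hgi
          (Eventually.of_forall fun z => ?_)
        simp only [hg]
        gcongr
        rw [norm_sub_rev]
        exact hBsub _ _
    _ = ∫ t in Ioo 0 T, ∫ x, g t * |u (t, x)| := integral_prod _ hgi
    _ = ∫ t in Ioo 0 T, P * (T + 2) * (w (ε t) *
          Real.exp (∫ r in t..T, c * (w (ε r) / ε r)) * ∫ x, |u (t, x)|) := by
        refine setIntegral_congr_fun measurableSet_Ioo fun t ht => ?_
        simp only [integral_const_mul, hg, hLeq t ht]
        ring
    _ = _ := integral_const_mul _ _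

end SpaceMollification

/-! ### Distributing dyadic scales over time under Osgood's condition. -/

section OsgoodSchedule

theorem intervalIntegrable_of_abs_le {f : ℝ → ℝ} (hf : Measurable f) {C : ℝ}
    (hC : ∀ t, |f t| ≤ C) (a b : ℝ) : IntervalIntegrable f volume a b :=
  (intervalIntegrable_const (c := C)).mono_fun hf.aestronglyMeasurable
    (Eventually.of_forall fun t => (hC t).trans (le_abs_self C))

/-- If `p = 1 + m` and `∫ p` is at most the sum of the first `N` durations `a * e k / W k`, then
the scales `e k` can be distributed over the time interval in such a way that the accumulated
growth is controlled. -/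
theorem exists_scale_schedule {T : ℝ} {m : ℝ → ℝ} (hm0 : ∀ t, 0 ≤ m t)
    (hm : IntervalIntegrable m volume 0 T) {e W : ℕ → ℝ} (he : ∀ k, 0 < e k) (hW : ∀ k, 0 < W k)
    {c : ℝ} (hc : 0 < c) {a q : ℝ} (hq : Real.exp (c * a) = q) (ha : 0 < a) (N : ℕ) :
    ∀ T' ∈ Icc 0 T, (∫ t in T'..T, (1 + m t)) ≤ ∑ k ∈ Finset.range N, a * (e k / W k) →
      ∃ κ : ℝ → ℕ, Measurable κ ∧ (∀ t, κ t ≤ N)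
        ∧ (∫ t in T'..T, c * (W (κ t) / e (κ t))) ≤ c * a * N
        ∧ (∫ t in T'..T, W (κ t) * Real.exp (∫ r in t..T, c * (W (κ r) / e (κ r))) * m t)
          ≤ ∑ k ∈ Finset.range N, a * e k * q ^ (k + 1) := by
  have hq0 : 0 < q := hq ▸ Real.exp_pos _
  have hLm : ∀ κ : ℝ → ℕ, Measurable κ → Measurable fun t => c * (W (κ t) / e (κ t)) :=
    fun κ hκ => (measurable_from_nat (f := fun k => c * (W k / e k))).comp hκ
  have hWm : ∀ κ : ℝ → ℕ, Measurable κ → Measurable fun t => W (κ t) :=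
    fun κ hκ => (measurable_from_nat (f := W)).comp hκ
  have hL0 : ∀ k, 0 ≤ c * (W k / e k) := fun k =>
    mul_nonneg hc.le (div_nonneg (hW k).le (he k).le)
  have hbd : ∀ f : ℕ → ℝ, (∀ k, 0 ≤ f k) → ∀ N, ∀ k ≤ N, |f k| ≤ ∑ j ∈ Finset.range (N + 1), f j :=
    fun f hf N k hk => by
      rw [abs_of_nonneg (hf k)]
      exact Finset.single_le_sum (fun j _ => hf j) (Finset.mem_range.2 (by omega))
  have hLi : ∀ κ : ℝ → ℕ, Measurable κ → ∀ N, (∀ t, κ t ≤ N) → ∀ s s',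
      IntervalIntegrable (fun t => c * (W (κ t) / e (κ t))) volume s s' := fun κ hκ N hN s s' =>
    intervalIntegrable_of_abs_le (hLm κ hκ) (fun t => hbd _ hL0 N (κ t) (hN t)) s s'
  have hp : ∀ s ∈ Icc 0 T, ∀ s' ∈ Icc 0 T,
      IntervalIntegrable (fun t => 1 + m t) volume s s' := fun s hs s' hs' =>
    intervalIntegrable_const.add (hm.mono_set (by
      rw [uIcc_of_le (hs.1.trans hs.2)]; exact uIcc_subset_Icc hs hs'))
  have hm' : ∀ s ∈ Icc 0 T, ∀ s' ∈ Icc 0 T,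
      IntervalIntegrable m volume s s' := fun s hs s' hs' =>
    hm.mono_set (by rw [uIcc_of_le (hs.1.trans hs.2)]; exact uIcc_subset_Icc hs hs')
  have hFi : ∀ κ : ℝ → ℕ, Measurable κ → ∀ N, (∀ t, κ t ≤ N) → ∀ s ∈ Icc 0 T, ∀ s' ∈ Icc 0 T,
      IntervalIntegrable (fun t => W (κ t) *
        Real.exp (∫ r in t..T, c * (W (κ r) / e (κ r))) * m t) volume s s' := by
    intro κ hκ N hN s hs s' hs'
    have h1 := continuous_mul_exp_integral (hLi κ hκ N hN) 1 T
    simp only [one_mul] at h1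
    have h2 : IntervalIntegrable (fun t => W (κ t) * m t) volume s s' := by
      rw [intervalIntegrable_iff] at *
      have := (hm' s hs s' hs').def'
      refine this.bdd_mul (c := ∑ j ∈ Finset.range (N + 1), W j)
        (hWm κ hκ).aestronglyMeasurable (Eventually.of_forall fun t => ?_)
      exact hbd W (fun k => (hW k).le) N _ (hN t)
    convert! h2.continuousOn_mul h1.continuousOn using 2 with t
    ring
  -- The interval is filled backward from `T`: the induction hypothesis handles `[S, T]` with the
  -- first `N` scales, and the next scale `e N` is placed on `[T', S]`.
  induction N with
  | zero =>
    intro T' hT' h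
    simp only [Finset.range_zero, Finset.sum_empty] at h
    have h1 : T - T' ≤ ∫ t in T'..T, (1 + m t) := by
      have := intervalIntegral.integral_mono_on hT'.2 intervalIntegrable_const
        (hp T' hT' T ⟨hT'.1.trans hT'.2, le_rfl⟩) (fun t _ => (by linarith [hm0 t] : 1 ≤ 1 + m t))
      simpa using this
    have h2 : T' = T := le_antisymm hT'.2 (by linarith)
    exact ⟨fun _ => 0, measurable_const, fun _ => le_rfl, by simp [h2], by simp [h2]⟩
  | succ N ih =>
    intro T' hT' h
    have hTT : T ∈ Icc 0 T := ⟨hT'.1.trans hT'.2, le_rfl⟩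
    obtain ⟨S, hS, hS1, hS2⟩ : ∃ S ∈ Icc T' T,
        (∫ t in S..T, (1 + m t)) ≤ ∑ k ∈ Finset.range N, a * (e k / W k) ∧
        (∫ t in T'..S, (1 + m t)) ≤ a * (e N / W N) := by
      have hσ0 : 0 ≤ ∑ k ∈ Finset.range N, a * (e k / W k) :=
        Finset.sum_nonneg fun k _ => mul_nonneg ha.le (div_nonneg (he k).le (hW k).le)
      by_cases hle : (∫ t in T'..T, (1 + m t)) ≤ ∑ k ∈ Finset.range N, a * (e k / W k)
      · refine ⟨T', left_mem_Icc.2 hT'.2, hle, ?_⟩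
        rw [intervalIntegral.integral_same]
        exact mul_nonneg ha.le (div_nonneg (he N).le (hW N).le)
      · push Not at hle
        have hc : ContinuousOn (fun s => ∫ t in s..T, (1 + m t)) (Icc T' T) := by
          simp_rw [intervalIntegral.integral_symm T]
          have := intervalIntegral.continuousOn_primitive_interval' (a := T) (b₁ := T') (b₂ := T)
            (hp T' hT' T hTT) right_mem_uIcc
          rw [uIcc_of_le hT'.2] at this
          exact this.neg
        -- `S` is where the first `N` durations are exactly used up, time being measured by `1 + m`.
        obtain ⟨S, hS, hSe⟩ := intermediate_value_Icc' hT'.2 hc (by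
          simp only [intervalIntegral.integral_same]
          exact ⟨hσ0, hle.le⟩)
        refine ⟨S, hS, hSe.le, ?_⟩
        have hadd := intervalIntegral.integral_add_adjacent_intervals
          (hp T' hT' S ⟨hT'.1.trans hS.1, hS.2⟩) (hp S ⟨hT'.1.trans hS.1, hS.2⟩ T hTT)
        rw [Finset.sum_range_succ] at h
        simp only at hSe
        linarith
    have hSI : S ∈ Icc 0 T := ⟨hT'.1.trans hS.1, hS.2⟩
    obtain ⟨κ₀, hκ₀m, hκ₀N, hκ₀1, hκ₀2⟩ := ih S hSI hS1
    set κ : ℝ → ℕ := fun t => if t ≤ S then N else κ₀ t with hκ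
    have hκm : Measurable κ := Measurable.ite measurableSet_Iic measurable_const hκ₀m
    have hκN : ∀ t, κ t ≤ N := fun t => by
      simp only [hκ]; split_ifs
      · exact le_rfl
      · exact hκ₀N t
    have hκN' : ∀ t, κ t ≤ N + 1 := fun t => (hκN t).trans N.le_succ
    have hκl : ∀ t ≤ S, κ t = N := fun t ht => by simp [hκ, ht]
    have hκr : ∀ t, S < t → κ t = κ₀ t := fun t ht => by simp [hκ, not_le.2 ht]
    -- The summand `1` in `1 + m` bounds the length of the block, hence its share `c * a` of the
    -- exponent; the summand `m` will bound the mass carried by the block.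
    have hle : S - T' ≤ a * (e N / W N) := by
      have := intervalIntegral.integral_mono_on hS.1 intervalIntegrable_const
        (hp T' hT' S hSI) (fun t _ => (by linarith [hm0 t] : 1 ≤ 1 + m t))
      simp only [intervalIntegral.integral_const, smul_eq_mul, mul_one] at this
      linarith
    have hWe := (hW N).ne'
    have hee := (he N).ne'
    have hLr : ∀ s, S ≤ s → s ≤ T → ∫ r in s..T, c * (W (κ r) / e (κ r))
        = ∫ r in s..T, c * (W (κ₀ r) / e (κ₀ r)) := fun s hs hsT => by
      refine intervalIntegral.integral_congr_ae (Eventually.of_forall fun r hr => ?_)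
      rw [uIoc_of_le hsT] at hr
      rw [hκr r (hs.trans_lt hr.1)]
    have hI1 : ∫ t in T'..T, c * (W (κ t) / e (κ t)) ≤ c * a * ((N + 1 : ℕ) : ℝ) := by
      rw [← intervalIntegral.integral_add_adjacent_intervals
        (hLi κ hκm _ hκN T' S) (hLi κ hκm _ hκN S T), hLr S le_rfl hS.2]
      have h1 : ∫ t in T'..S, c * (W (κ t) / e (κ t)) = (S - T') * (c * (W N / e N)) := by
        rw [← smul_eq_mul, ← intervalIntegral.integral_const]
        refine intervalIntegral.integral_congr fun t ht => ?_
        rw [uIcc_of_le hS.1] at ht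
        simp only [hκl t ht.2]
      have h2 : (S - T') * (c * (W N / e N)) ≤ a * (e N / W N) * (c * (W N / e N)) :=
        mul_le_mul_of_nonneg_right hle (hL0 N)
      have h3 : a * (e N / W N) * (c * (W N / e N)) = c * a := by field_simp
      push_cast
      linarith
    refine ⟨κ, hκm, hκN', hI1, ?_⟩
    rw [← intervalIntegral.integral_add_adjacent_intervals
      (hFi κ hκm _ hκN T' hT' S hSI) (hFi κ hκm _ hκN S hSI T hTT), Finset.sum_range_succ, add_comm]
    refine add_le_add ((le_of_eq ?_).trans hκ₀2) ?_
    · refine intervalIntegral.integral_congr_ae (Eventually.of_forall fun r hr => ?_)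
      rw [uIoc_of_le hS.2] at hr
      rw [hκr r hr.1, hLr r hr.1.le hr.2]
    · calc _ ≤ ∫ t in T'..S, W N * q ^ (N + 1) * (1 + m t) := by
            refine intervalIntegral.integral_mono_on hS.1 (hFi κ hκm _ hκN T' hT' S hSI)
              ((hp T' hT' S hSI).const_mul _) fun t ht => ?_
            rw [hκl t ht.2]
            have h1 : Real.exp (∫ r in t..T, c * (W (κ r) / e (κ r))) ≤ q ^ (N + 1) := by
              rw [← hq, ← Real.exp_nat_mul]
              refine Real.exp_le_exp.2 (le_trans ?_ (hI1.trans_eq (mul_comm _ _)))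
              exact intervalIntegral.integral_mono_interval ht.1 (ht.2.trans hS.2) le_rfl
                (Eventually.of_forall fun r => hL0 _) (hLi κ hκm _ hκN _ _)
            have := hW N
            gcongr
            · exact hm0 t
            · linarith
        _ = W N * q ^ (N + 1) * ∫ t in T'..S, (1 + m t) := intervalIntegral.integral_const_mul _ _
        _ ≤ W N * q ^ (N + 1) * (a * (e N / W N)) :=
            mul_le_mul_of_nonneg_left hS2 (mul_nonneg (hW N).le (pow_nonneg hq0.le _))
        _ = _ := by field_simp

/-- By divergence, finitely many durations exhaust `∫ (1 + m)`. With `a = log (3/2) / c` each block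
multiplies the exponential by at most `3/2` while the scale halves, so the sum is geometric of ratio
`3/4`: `a * δ * (3/2) * 4 = 6 * a * δ`. -/
theorem exists_scale_of_not_summable {T : ℝ} (hT : 0 ≤ T) {m : ℝ → ℝ} (hm0 : ∀ t, 0 ≤ m t)
    (hm : IntervalIntegrable m volume 0 T) {w : ℝ → ℝ} {δ : ℝ} (hδ : 0 < δ)
    (hw : ∀ k : ℕ, 0 < w (δ / 2 ^ k)) (hns : ¬ Summable fun k : ℕ => δ / 2 ^ k / w (δ / 2 ^ k))
    {c : ℝ} (hc : 0 < c) :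
    ∃ (ε : ℝ → ℝ) (ε₀ : ℝ), 0 < ε₀ ∧ Measurable ε ∧ Measurable (fun t => w (ε t))
      ∧ (∀ t, ε₀ ≤ ε t) ∧ (∀ t, ε t ≤ δ)
      ∧ ∫ t in 0..T, w (ε t) * Real.exp (∫ r in t..T, c * (w (ε r) / ε r)) * m t
        ≤ 6 * (Real.log (3 / 2) / c) * δ := by
  set e : ℕ → ℝ := fun k => δ / 2 ^ k with he
  have he0 : ∀ k, 0 < e k := fun k => by positivity
  set a := Real.log (3 / 2) / c with ha
  have ha0 : 0 < a := div_pos (Real.log_pos (by norm_num)) hc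
  have hq : Real.exp (c * a) = 3 / 2 := by
    rw [ha, mul_div_cancel₀ _ hc.ne', Real.exp_log (by norm_num)]
  have htop : Tendsto (fun N => ∑ k ∈ Finset.range N, a * (e k / w (e k))) atTop atTop := by
    simp_rw [← Finset.mul_sum]
    exact ((not_summable_iff_tendsto_nat_atTop_of_nonneg
      fun k => div_nonneg (he0 k).le (hw k).le).1 hns).const_mul_atTop ha0
  obtain ⟨N, hN⟩ := (htop.eventually_ge_atTop (∫ t in 0..T, (1 + m t))).exists
  obtain ⟨κ, hκm, hκN, -, hκ⟩ := exists_scale_schedule hm0 hm he0 hw hc hq ha0 N 0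
    (left_mem_Icc.2 hT) hN
  refine ⟨fun t => e (κ t), e N, he0 N, (measurable_from_nat (f := e)).comp hκm,
    (measurable_from_nat (f := fun k => w (e k))).comp hκm, fun t => ?_, fun t => ?_, ?_⟩
  · simp only [he]
    gcongr
    · norm_num
    · exact hκN t
  · exact div_le_self hδ.le (one_le_pow₀ (by norm_num))
  · refine hκ.trans ?_
    have h1 : ∀ k, a * e k * (3 / 2 : ℝ) ^ (k + 1) = a * δ * (3 / 2) * (3 / 4 : ℝ) ^ k := fun k => by
      have : (3 / 4 : ℝ) ^ k = (3 / 2) ^ k / 2 ^ k := by rw [← div_pow]; norm_num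
      simp only [he]
      rw [this, pow_succ]
      ring
    simp_rw [h1]
    rw [← Finset.mul_sum]
    have h2 : ∑ k ∈ Finset.range N, (3 / 4 : ℝ) ^ k ≤ 4 := by
      have h := (summable_geometric_of_lt_one (r := (3 / 4 : ℝ)) (by norm_num)
        (by norm_num)).sum_le_tsum (Finset.range N) fun k _ => by positivity
      rw [tsum_geometric_of_lt_one (by norm_num) (by norm_num)] at h
      exact h.trans_eq (by norm_num)
    have h3 : 0 ≤ a * δ * (3 / 2) := by positivity
    nlinarith

end OsgoodSchedule

theorem continuous_of_norm_sub_le_modulus {w : ℝ → ℝ} (hw : MonotoneOn w (Ici 0)) {r : ℝ}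
    (hr : 0 < r) (hw0 : Tendsto (fun k : ℕ => w (r / 2 ^ k)) atTop (𝓝 0)) {F : Type*}
    [NormedAddCommGroup F] {f : F → F}
    (hf : ∀ x y, ‖f x - f y‖ ≤ w ‖x - y‖) : Continuous f := by
  refine Metric.continuous_iff.2 fun x ε hε => ?_
  obtain ⟨k, hk⟩ := (hw0.eventually (gt_mem_nhds hε)).exists
  refine ⟨r / 2 ^ k, by positivity, fun y hy => ?_⟩
  rw [dist_eq_norm] at hy ⊢
  exact ((hf y x).trans (hw (mem_Ici.2 (norm_nonneg _))
    (mem_Ici.2 (by positivity)) hy.le)).trans_lt hk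

/-! ### Vanishing of the pairing, and a measurable version of the field. -/

section Uniqueness

variable {E : Type*} [NormedAddCommGroup E] [InnerProductSpace ℝ E] [FiniteDimensional ℝ E]
  [MeasureSpace E] [BorelSpace E] [(volume : Measure E).IsAddHaarMeasure]

/-- Start the schedule at `δ = r / 2 ^ k`; tails of a divergent series diverge, so this is possible
for every `k`, and the bound is `O(δ)`. -/
theorem integral_mul_eq_zero_of_osgood {T : ℝ} (hT : 0 < T) {b : ℝ × E → E} (hb : Measurable b)
    {N : ℝ} (hN : ∀ z, ‖b z‖ ≤ N) (hb0 : ∀ t ∉ Ioo 0 T, ∀ x, b (t, x) = 0)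
    {w : ℝ → ℝ} (hw : MonotoneOn w (Ici 0))
    (hbw : ∀ t x y, ‖b (t, x) - b (t, y)‖ ≤ w ‖x - y‖) {r : ℝ} (hr : 0 < r)
    (hwr : ∀ k : ℕ, 0 < w (r / 2 ^ k)) (hns : ¬ Summable fun k : ℕ => r / 2 ^ k / w (r / 2 ^ k))
    {G : ℝ → ℝ} (hG : Continuous G) (hG0 : ∀ s, 0 < G s) (hGm : MonotoneOn G (Ici 0))
    (hbG : ∀ t x, ‖b (t, x)‖ + w r ≤ G ‖x‖)
    {ψ : ℝ × E → ℝ} (hψ : Continuous ψ) {P Q : ℝ} (hP : 0 ≤ P)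
    (hψL : ∀ t x y, |ψ (t, x) - ψ (t, y)| ≤ P * ‖x - y‖) (hψQ : ∀ z, |ψ z| ≤ Q)
    {T₀ : ℝ} (hT₀ : T₀ < T) (hψT : ∀ t x, T₀ ≤ t → ψ (t, x) = 0)
    {R R' : ℝ} (hRR' : R ≤ R') (hψR : ∀ t x, R < ‖x‖ → ψ (t, x) = 0)
    (hR' : (∫ r in 0..√(1 + R ^ 2), (G r)⁻¹) + (T + 2) < ∫ r in 0..R', (G r)⁻¹)
    {u : ℝ × E → ℝ} (hu : Integrable u ((volume.restrict (Ioo 0 T)).prod volume))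
    (hweak : ∀ φ : ℝ × E → ℝ, ContDiff ℝ ∞ φ → HasCompactSupport φ →
      tsupport φ ⊆ Iio T ×ˢ Metric.ball 0 (R' + 1) →
      ∫ z, fderiv ℝ φ z (1, b z) * u z ∂((volume.restrict (Ioo 0 T)).prod volume) = 0) :
    ∫ z, ψ z * u z ∂((volume.restrict (Ioo 0 T)).prod volume) = 0 := by
  obtain ⟨c, hc, hmain⟩ := exists_abs_integral_mul_le_of_modulus E
  have hm : IntervalIntegrable (fun t => ∫ x, |u (t, x)|) volume 0 T :=
    (intervalIntegrable_iff_integrableOn_Ioo_of_le hT.le).2 hu.abs.integral_prod_left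
  have hle : ∀ k : ℕ, |∫ z, ψ z * u z ∂((volume.restrict (Ioo 0 T)).prod volume)|
      ≤ P * (T + 2) * (6 * (Real.log (3 / 2) / c) * (r / 2 ^ k)) := by
    intro k
    have hk : ∀ j : ℕ, r / 2 ^ k / 2 ^ j = r / 2 ^ (j + k) := fun j => by
      rw [div_div, ← pow_add, add_comm]
    obtain ⟨ε, ε₀, hε₀, hεm, hwε, hεl, hεu, hεint⟩ := exists_scale_of_not_summable hT.le
      (fun t => integral_nonneg fun x => abs_nonneg (u (t, x))) hm (w := w) (δ := r / 2 ^ k)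
      (by positivity) (fun j => by rw [hk]; exact hwr _)
      (by
        simp_rw [hk]
        rwa [summable_nat_add_iff (f := fun k : ℕ => r / 2 ^ k / w (r / 2 ^ k)) k]) hc
    refine (hmain hT hb hN hb0 hw hbw hG hG0 hGm hbG hψ hP hψL hψQ hT₀ hψT hRR' hψR hR' hu hweak
      hεm hwε hε₀ hεl fun t => (hεu t).trans
        (div_le_self hr.le (one_le_pow₀ one_le_two))).trans ?_
    rw [← integral_Ioc_eq_integral_Ioo, ← intervalIntegral.integral_of_le hT.le]
    gcongr
  have hlim : Tendsto (fun k : ℕ => P * (T + 2) * (6 * (Real.log (3 / 2) / c) * (r / 2 ^ k)))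
      atTop (𝓝 0) := by
    have h1 : Tendsto (fun k : ℕ => r / (2 : ℝ) ^ k) atTop (𝓝 0) :=
      tendsto_const_nhds.div_atTop (tendsto_pow_atTop_atTop_of_one_lt one_lt_two)
    simpa using (h1.const_mul (6 * (Real.log (3 / 2) / c))).const_mul (P * (T + 2))
  exact abs_nonpos_iff.1 (ge_of_tendsto' hlim hle)

/-- Set `b` to zero on a null set of bad times. On good times it is continuous in `x`, hence the
limit of its mollifications. These do not see null sets in `x`, so they agree with the
mollifications of a measurable representative, which are jointly measurable. -/
theorem exists_measurable_regular_version {T : ℝ} {b : ℝ → E → E}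
    (hb : AEStronglyMeasurable (Function.uncurry b) ((volume.restrict (Ioo 0 T)).prod volume))
    {w : ℝ → ℝ} (hw : MonotoneOn w (Ici 0)) (hwnn : ∀ s, 0 ≤ s → 0 ≤ w s) {r : ℝ}
    (hr : 0 < r) (hw0 : Tendsto (fun k : ℕ => w (r / 2 ^ k)) atTop (𝓝 0))
    {p : (E → E) → Prop} (hp0 : p fun _ => 0)
    (hbp : ∀ᵐ t ∂(volume.restrict (Ioo 0 T)), p (b t))
    (hbw : ∀ᵐ t ∂(volume.restrict (Ioo 0 T)), ∀ x y, ‖b t x - b t y‖ ≤ w ‖x - y‖) :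
    ∃ b' : ℝ × E → E, Measurable b' ∧ (∀ t ∉ Ioo 0 T, ∀ x, b' (t, x) = 0)
      ∧ (∀ t, p fun x => b' (t, x)) ∧ (∀ t x y, ‖b' (t, x) - b' (t, y)‖ ≤ w ‖x - y‖)
      ∧ ∀ᵐ t ∂(volume.restrict (Ioo 0 T)), ∀ x, b' (t, x) = b t x := by
  classical
  obtain ⟨η, -, hη, -, -⟩ := exists_mollify_lipschitz E
  have hmk : ∀ᵐ t ∂(volume.restrict (Ioo 0 T)), ∀ᵐ x, b t x = hb.mk _ (t, x) :=
    Measure.ae_ae_of_ae_prod hb.ae_eq_mk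
  obtain ⟨S, hS, hSm, hSall⟩ := (hbp.and (hbw.and (hmk.and
    (ae_restrict_mem measurableSet_Ioo)))).exists_measurable_mem
  set b' : ℝ × E → E := fun z => if z.1 ∈ S then b z.1 z.2 else 0 with hb'
  have hin : ∀ t ∈ S, ∀ x, b' (t, x) = b t x := fun t ht x => by simp [hb', ht]
  have hout : ∀ t ∉ S, ∀ x, b' (t, x) = 0 := fun t ht x => by simp [hb', ht]
  have hmeas : Measurable (hb.mk _) := hb.stronglyMeasurable_mk.measurable
  refine ⟨b', ?_, fun t ht x => hout t (fun h => ht (hSall t h).2.2.2) x, fun t => ?_,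
    fun t x y => ?_, ?_⟩
  · refine measurable_of_tendsto_metrizable (f := fun (k : ℕ) (z : ℝ × E) => if z.1 ∈ S then
      ∫ y, η.normed volume y • hb.mk _ (z.1, z.2 - (r / 2 ^ k) • y) else 0) (fun k => ?_) ?_
    · have h1 : Measurable fun q : (ℝ × E) × E =>
          η.normed volume q.2 • hb.mk _ (q.1.1, q.1.2 - (r / 2 ^ k) • q.2) := by
        have h2 : Measurable fun q : (ℝ × E) × E => η.normed (volume : Measure E) q.2 :=
          (η.continuous_normed (μ := volume)).measurable.comp measurable_snd
        have h3 : Measurable fun q : (ℝ × E) × E =>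
            hb.mk _ (q.1.1, q.1.2 - (r / 2 ^ k) • q.2) :=
          hmeas.comp ((measurable_fst.comp measurable_fst).prodMk
            ((measurable_snd.comp measurable_fst).sub (measurable_snd.const_smul _)))
        exact h2.smul h3
      exact Measurable.ite (measurable_fst hSm)
        (h1.stronglyMeasurable.integral_prod_right (ν := volume)).measurable measurable_const
    · rw [tendsto_pi_nhds]
      rintro ⟨t, x⟩
      by_cases ht : t ∈ S
      · simp only [hb', ht, if_true]
        obtain ⟨-, htw, hte, -⟩ := hSall t ht
        have hc : Continuous (b t) := continuous_of_norm_sub_le_modulus hw hr hw0 htw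
        have heq : ∀ k : ℕ, ∫ y, η.normed volume y • hb.mk _ (t, x - (r / 2 ^ k) • y)
            = η.mollify (b t) (r / 2 ^ k) x := fun k => by
          have hqmp : Measure.QuasiMeasurePreserving (fun y : E => x - (r / 2 ^ k) • y)
              volume volume := by
            have h1 := (Measure.measurePreserving_sub_left (volume : Measure E) x).quasiMeasurePreserving
            have hne : r / 2 ^ k ≠ 0 := by positivity
            have h2 : Measure.QuasiMeasurePreserving (fun y : E => (r / 2 ^ k) • y)
                volume volume := by
              refine ⟨measurable_const_smul _, ?_⟩
              rw [Measure.map_addHaar_smul _ hne]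
              exact Measure.smul_absolutelyContinuous
            exact h1.comp h2
          refine integral_congr_ae ?_
          filter_upwards [hqmp.ae hte] with y hy
          rw [hy]
        simp_rw [heq]
        rw [tendsto_iff_norm_sub_tendsto_zero]
        refine squeeze_zero (fun k => norm_nonneg _) (fun k => ?_) hw0
        refine η.norm_mollify_sub_le hη hw htw (by positivity) x ?_
        exact ((η.continuous_normed (μ := volume)).smul
          (hc.comp (by fun_prop))).integrable_of_hasCompactSupport
            η.hasCompactSupport_normed.smul_right
      · simp [hb', ht]
  · by_cases ht : t ∈ S
    · simp only [hin t ht]; exact (hSall t ht).1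
    · simp only [hout t ht]; exact hp0
  · by_cases ht : t ∈ S
    · rw [hin t ht, hin t ht]; exact (hSall t ht).2.1 x y
    · rw [hout t ht, hout t ht]
      simpa using hwnn _ (norm_nonneg _)
  · filter_upwards [hS] with t ht x using hin t ht x

end Uniqueness

/-! ### Truncation, and vanishing of solutions with zero datum. -/

section EuclideanSpace

variable {n : ℕ}

/-- Coordinatewise truncation to the cube `[-ρ, ρ]ⁿ`. -/
noncomputable def EuclideanSpace.truncate (ρ : ℝ) (x : EuclideanSpace ℝ (Fin n)) :
    EuclideanSpace ℝ (Fin n) :=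
  WithLp.toLp 2 fun i => max (-ρ) (min ρ (x i))

namespace EuclideanSpace

theorem norm_truncate_sub_le (ρ : ℝ) (x y : EuclideanSpace ℝ (Fin n)) :
    ‖truncate ρ x - truncate ρ y‖ ≤ ‖x - y‖ := by
  rw [EuclideanSpace.norm_eq, EuclideanSpace.norm_eq]
  refine Real.sqrt_le_sqrt (Finset.sum_le_sum fun i _ => ?_)
  refine pow_le_pow_left₀ (norm_nonneg _) ?_ 2
  simp only [truncate, PiLp.sub_apply, Real.norm_eq_abs]
  calc |max (-ρ) (min ρ (x i)) - max (-ρ) (min ρ (y i))| ≤ |min ρ (x i) - min ρ (y i)| := by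
        simpa using abs_max_sub_max_le_max (-ρ) (min ρ (x i)) (-ρ) (min ρ (y i))
    _ ≤ |x i - y i| := by simpa using abs_min_sub_min_le_max ρ (x i) ρ (y i)

theorem continuous_truncate (ρ : ℝ) :
    Continuous (truncate ρ : EuclideanSpace ℝ (Fin n) → EuclideanSpace ℝ (Fin n)) :=
  (LipschitzWith.of_dist_le_mul (K := 1) fun x y => by
    rw [dist_eq_norm, dist_eq_norm, NNReal.coe_one, one_mul]
    exact norm_truncate_sub_le ρ x y).continuous

theorem truncate_of_norm_le {ρ : ℝ} {x : EuclideanSpace ℝ (Fin n)} (hx : ‖x‖ ≤ ρ) :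
    truncate ρ x = x := by
  ext i
  have := (PiLp.norm_apply_le x i).trans hx
  rw [Real.norm_eq_abs, abs_le] at this
  simp [truncate, this.1, this.2]

theorem norm_truncate_le_norm {ρ : ℝ} (hρ : 0 ≤ ρ) (x : EuclideanSpace ℝ (Fin n)) :
    ‖truncate ρ x‖ ≤ ‖x‖ := by
  have := norm_truncate_sub_le ρ x 0
  rwa [truncate_of_norm_le (x := 0) (by simpa using hρ), sub_zero, sub_zero] at this

theorem norm_truncate_le {ρ : ℝ} (hρ : 0 ≤ ρ) (x : EuclideanSpace ℝ (Fin n)) :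
    ‖truncate ρ x‖ ≤ √(n * ρ ^ 2) := by
  rw [EuclideanSpace.norm_eq]
  refine Real.sqrt_le_sqrt ?_
  calc ∑ i, ‖truncate ρ x i‖ ^ 2 ≤ ∑ _i : Fin n, ρ ^ 2 := by
        refine Finset.sum_le_sum fun i _ => pow_le_pow_left₀ (norm_nonneg _) ?_ 2
        simp only [truncate, Real.norm_eq_abs]
        rw [abs_le]
        exact ⟨le_max_left _ _, max_le (by linarith) (min_le_left _ _)⟩
    _ = _ := by simp

end EuclideanSpace

/-- For a given `ψ`, divergence of `∫ dr / G` supplies a radius `R'` confining the dual solutions.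
Composing the field with truncation to the cube `[-(R' + 1), R' + 1]ⁿ` makes it bounded. Truncation
is nonexpansive and fixes the ball of radius `R' + 1`, so modulus, growth and the relevant weak
equation are kept. -/
theorem ae_eq_zero_of_forall_integral_fderiv_eq_zero {T : ℝ} (hT : 0 < T)
    {b : ℝ → EuclideanSpace ℝ (Fin n) → EuclideanSpace ℝ (Fin n)}
    (hb : AEStronglyMeasurable (Function.uncurry b) ((volume.restrict (Ioo 0 T)).prod volume))
    {w : ℝ → ℝ} (hw : MonotoneOn w (Ici 0)) (hwnn : ∀ s, 0 ≤ s → 0 ≤ w s) {r : ℝ} (hr : 0 < r)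
    (hw0 : Tendsto (fun k : ℕ => w (r / 2 ^ k)) atTop (𝓝 0))
    (hwr : ∀ k : ℕ, 0 < w (r / 2 ^ k)) (hns : ¬ Summable fun k : ℕ => r / 2 ^ k / w (r / 2 ^ k))
    {G : ℝ → ℝ} (hG : Continuous G) (hGm : MonotoneOn G (Ici 0))
    (hG0 : ∀ s, 0 < G s) (hwG : w r ≤ G 0)
    (hGtop : Tendsto (fun R => ∫ r in 0..R, (G r)⁻¹) atTop atTop)
    (hbG : ∀ᵐ t ∂(volume.restrict (Ioo 0 T)), ∀ x, ‖b t x‖ + w r ≤ G ‖x‖)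
    (hbw : ∀ᵐ t ∂(volume.restrict (Ioo 0 T)), ∀ x y, ‖b t x - b t y‖ ≤ w ‖x - y‖)
    {u : ℝ × EuclideanSpace ℝ (Fin n) → ℝ}
    (hu : Integrable u ((volume.restrict (Ioo 0 T)).prod volume))
    (hweak : ∀ φ : ℝ × EuclideanSpace ℝ (Fin n) → ℝ, ContDiff ℝ ∞ φ → HasCompactSupport φ →
      tsupport φ ⊆ Iio T ×ˢ univ →
      ∫ z, fderiv ℝ φ z (1, b z.1 z.2) * u z ∂((volume.restrict (Ioo 0 T)).prod volume) = 0) :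
    u =ᵐ[(volume.restrict (Ioo 0 T)).prod volume] 0 := by
  obtain ⟨b₁, hb₁m, hb₁0, hb₁G, hb₁w, hb₁eq⟩ := exists_measurable_regular_version hb hw hwnn hr hw0
    (p := fun f => ∀ x, ‖f x‖ + w r ≤ G ‖x‖) (fun x => by
      rw [norm_zero, zero_add]
      exact hwG.trans (hGm (mem_Ici.2 le_rfl) (mem_Ici.2 (norm_nonneg _)) (norm_nonneg _)))
    hbG hbw
  set μ : Measure (ℝ × EuclideanSpace ℝ (Fin n)) := (volume.restrict (Ioo 0 T)).prod volume with hμ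
  have hμr : μ = (volume : Measure (ℝ × EuclideanSpace ℝ (Fin n))).restrict (Ioo 0 T ×ˢ univ) := by
    rw [hμ, Measure.volume_eq_prod, ← Measure.prod_restrict, Measure.restrict_univ]
  have hzero : ∀ ψ : ℝ × EuclideanSpace ℝ (Fin n) → ℝ, ContDiff ℝ ∞ ψ → HasCompactSupport ψ →
      tsupport ψ ⊆ Ioo 0 T ×ˢ univ → ∫ z, ψ z * u z ∂μ = 0 := by
    intro ψ hψC hψK hψs
    obtain ⟨Q, hQ⟩ := hψK.exists_bound_of_continuous hψC.continuous
    obtain ⟨P, hP⟩ := ContDiff.lipschitzWith_of_hasCompactSupport hψK hψC (by simp)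
    obtain ⟨T₀, hT₀, hψT⟩ : ∃ T₀ < T, ∀ t x, T₀ ≤ t → ψ (t, x) = 0 := by
      rcases (tsupport ψ).eq_empty_or_nonempty with he | hne
      · exact ⟨0, hT, fun t x _ => image_eq_zero_of_notMem_tsupport (by simp [he])⟩
      · obtain ⟨z, hz, hmax⟩ := hψK.isCompact.exists_isMaxOn hne continuous_fst.continuousOn
        have hzT := (hψs hz).1.2
        refine ⟨(z.1 + T) / 2, by linarith, fun t x ht => image_eq_zero_of_notMem_tsupport ?_⟩
        intro hmem
        have h1 : t ≤ z.1 := hmax hmem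
        linarith
    obtain ⟨R, hR⟩ := hψK.isCompact.isBounded.subset_closedBall 0
    have hψR : ∀ t x, R < ‖x‖ → ψ (t, x) = 0 := fun t x hx =>
      image_eq_zero_of_notMem_tsupport fun hmem => by
        have h1 := mem_closedBall_zero_iff.1 (hR hmem)
        exact absurd ((norm_snd_le (t, x)).trans h1) (not_le.2 hx)
    obtain ⟨R', hR', hRR'⟩ := ((hGtop.eventually_gt_atTop
      ((∫ r in 0..√(1 + R ^ 2), (G r)⁻¹) + (T + 2))).and
        (eventually_ge_atTop (max R 0))).exists
    have hR'0 : 0 ≤ R' + 1 := by linarith [(le_max_right R 0).trans hRR']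
    refine integral_mul_eq_zero_of_osgood hT
      (b := fun z => b₁ (z.1, EuclideanSpace.truncate (R' + 1) z.2))
      (N := G √(n * (R' + 1) ^ 2)) ?_ ?_ ?_ hw ?_ hr hwr hns hG hG0 hGm ?_
      hψC.continuous P.coe_nonneg ?_ hQ hT₀ hψT ((le_max_left _ _).trans hRR') hψR hR' hu ?_
    · exact hb₁m.comp (measurable_fst.prodMk
        ((EuclideanSpace.continuous_truncate _).measurable.comp measurable_snd))
    · intro z
      refine (le_trans (by linarith [hwnn r hr.le]) (hb₁G z.1 _)).trans
        (hGm (mem_Ici.2 (norm_nonneg _)) (mem_Ici.2 (Real.sqrt_nonneg _))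
          (EuclideanSpace.norm_truncate_le hR'0 z.2))
    · intro t ht x
      exact hb₁0 t ht _
    · intro t x y
      exact (hb₁w t _ _).trans (hw (mem_Ici.2 (norm_nonneg _)) (mem_Ici.2 (norm_nonneg _))
        (EuclideanSpace.norm_truncate_sub_le _ x y))
    · intro t x
      exact (hb₁G t _).trans (hGm (mem_Ici.2 (norm_nonneg _)) (mem_Ici.2 (norm_nonneg _))
        (EuclideanSpace.norm_truncate_le_norm hR'0 x))
    · intro t x y
      have := hP.dist_le_mul (t, x) (t, y)
      rwa [Prod.dist_eq, dist_self, max_eq_right dist_nonneg, Real.dist_eq, dist_eq_norm] at this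
    · intro φ hφC hφK hφs
      refine (integral_congr_ae ?_).trans
        (hweak φ hφC hφK (hφs.trans (prod_mono_right (subset_univ _))))
      have hae : ∀ᵐ z ∂μ, ∀ x, b₁ (z.1, x) = b z.1 x :=
        Measure.quasiMeasurePreserving_fst.ae hb₁eq
      filter_upwards [hae] with z hz
      by_cases hzs : z ∈ tsupport φ
      · have h1 := (hφs hzs).2
        rw [mem_ball_zero_iff] at h1
        rw [hz, EuclideanSpace.truncate_of_norm_le h1.le]
      · rw [fderiv_of_notMem_tsupport ℝ hzs]
        simp
  have hvol : (volume : Measure (ℝ × EuclideanSpace ℝ (Fin n))).IsAddHaarMeasure :=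
    Measure.prod.instIsAddHaarMeasure volume volume
  have hU : IsOpen (Ioo 0 T ×ˢ (univ : Set (EuclideanSpace ℝ (Fin n)))) :=
    isOpen_Ioo.prod isOpen_univ
  have hae : ∀ᵐ z : ℝ × EuclideanSpace ℝ (Fin n), z ∈ Ioo 0 T ×ˢ univ → u z = 0 := by
    refine hU.ae_eq_zero_of_integral_contDiff_smul_eq_zero ?_ ?_
    · rw [hμr] at hu
      exact IntegrableOn.locallyIntegrableOn hu
    · intro ψ hψC hψK hψs
      have h0 := hzero ψ hψC hψK hψs
      rw [hμr, setIntegral_eq_integral_of_forall_compl_eq_zero] at h0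
      · exact h0
      intro z hz
      rw [image_eq_zero_of_notMem_tsupport fun h => hz (hψs h), zero_mul]
  rw [hμr, EventuallyEq, ae_restrict_iff' (measurableSet_Ioo.prod MeasurableSet.univ)]
  exact hae

end EuclideanSpace

/-! ### Weak solutions, and verification of the Osgood and growth hypotheses. -/

namespace ContinuityEquation

theorem fderiv_apply_one_eq_deriv_add_inner {n : ℕ} {φ : ℝ × EuclideanSpace ℝ (Fin n) → ℝ}
    (hφ : ContDiff ℝ ∞ φ) (t : ℝ) (x y : EuclideanSpace ℝ (Fin n)) :
    fderiv ℝ φ (t, x) (1, y)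
      = deriv (fun s => φ (s, x)) t + inner ℝ y (gradient (fun y => φ (t, y)) x) := by
  have hd : HasFDerivAt φ (fderiv ℝ φ (t, x)) (t, x) :=
    (hφ.differentiable (by simp) (t, x)).hasFDerivAt
  have h1 : HasDerivAt (fun s => φ (s, x)) (fderiv ℝ φ (t, x) (1, 0)) t :=
    hd.comp_hasDerivAt t ((hasDerivAt_id t).prodMk (hasDerivAt_const t x))
  have h2 : HasFDerivAt (fun y => φ (t, y))
      ((fderiv ℝ φ (t, x)).comp (ContinuousLinearMap.inr ℝ ℝ (EuclideanSpace ℝ (Fin n)))) x :=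
    hd.comp x (hasFDerivAt_prodMk_right t x)
  rw [h1.deriv, gradient, real_inner_comm, InnerProductSpace.toDual_symm_apply, h2.fderiv,
    ContinuousLinearMap.comp_apply, ContinuousLinearMap.inr_apply, ← map_add]
  simp

theorem integrable_fderiv_mul {n : ℕ} {T : ℝ}
    {b : ℝ → EuclideanSpace ℝ (Fin n) → EuclideanSpace ℝ (Fin n)}
    (hb : AEStronglyMeasurable (Function.uncurry b) ((volume.restrict (Ioo 0 T)).prod volume))
    {G : ℝ → ℝ} (hGm : MonotoneOn G (Ici 0))
    (hbG : ∀ᵐ t ∂(volume.restrict (Ioo 0 T)), ∀ x, ‖b t x‖ ≤ G ‖x‖)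
    {ρ : ℝ × EuclideanSpace ℝ (Fin n) → ℝ}
    (hρ : Integrable ρ ((volume.restrict (Ioo 0 T)).prod volume))
    {φ : ℝ × EuclideanSpace ℝ (Fin n) → ℝ} (hφ : ContDiff ℝ ∞ φ) (hφK : HasCompactSupport φ) :
    Integrable (fun z => fderiv ℝ φ z (1, b z.1 z.2) * ρ z)
      ((volume.restrict (Ioo 0 T)).prod volume) := by
  obtain ⟨D, hD⟩ := hφ.exists_norm_fderiv_le hφK
  obtain ⟨R, hR⟩ := hφK.isCompact.isBounded.subset_closedBall 0
  have hD0 : 0 ≤ D := (norm_nonneg _).trans (hD 0)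
  have hc : Continuous fun q : (ℝ × EuclideanSpace ℝ (Fin n)) × ℝ × EuclideanSpace ℝ (Fin n) =>
      fderiv ℝ φ q.1 q.2 :=
    ((hφ.continuous_fderiv (by simp)).comp continuous_fst).clm_apply continuous_snd
  refine hρ.bdd_mul (c := D * (1 + |G (|R|)|)) ?_ ?_
  · exact hc.comp_aestronglyMeasurable
      (aestronglyMeasurable_id.prodMk (aestronglyMeasurable_const.prodMk hb))
  · filter_upwards [Measure.quasiMeasurePreserving_fst.ae hbG] with z hz
    by_cases hzs : z ∈ tsupport φ
    · refine ((fderiv ℝ φ z).le_opNorm _).trans ?_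
      refine mul_le_mul (hD z) ?_ (norm_nonneg _) hD0
      have h1 : ‖z.2‖ ≤ |R| :=
        ((norm_snd_le z).trans (mem_closedBall_zero_iff.1 (hR hzs))).trans (le_abs_self R)
      have h2 : ‖b z.1 z.2‖ ≤ |G (|R|)| := (hz z.2).trans
        ((hGm (mem_Ici.2 (norm_nonneg _)) (mem_Ici.2 (abs_nonneg R)) h1).trans (le_abs_self _))
      rw [Prod.norm_def]
      simp only [norm_one]
      exact max_le (by linarith [abs_nonneg (G (|R|))]) (by linarith)
    · rw [fderiv_of_notMem_tsupport ℝ hzs]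
      simp only [_root_.zero_apply, norm_zero]
      positivity

theorem IsWeakSolution.integral_fderiv_mul {n : ℕ} {T : ℝ}
    {b : ℝ → EuclideanSpace ℝ (Fin n) → EuclideanSpace ℝ (Fin n)}
    (hb : AEStronglyMeasurable (Function.uncurry b) ((volume.restrict (Ioo 0 T)).prod volume))
    {G : ℝ → ℝ} (hGm : MonotoneOn G (Ici 0))
    (hbG : ∀ᵐ t ∂(volume.restrict (Ioo 0 T)), ∀ x, ‖b t x‖ ≤ G ‖x‖)
    {ρ₀ : EuclideanSpace ℝ (Fin n) → ℝ} {ρ : ℝ → EuclideanSpace ℝ (Fin n) → ℝ}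
    (hρ : IsWeakSolution T b ρ₀ ρ)
    {φ : ℝ × EuclideanSpace ℝ (Fin n) → ℝ} (hφ : IsTestFunction T φ) :
    ∫ z, fderiv ℝ φ z (1, b z.1 z.2) * Function.uncurry ρ z
      ∂((volume.restrict (Ioo 0 T)).prod volume) + ∫ x, φ (0, x) * ρ₀ x = 0 := by
  rw [integral_prod _ (integrable_fderiv_mul hb hGm hbG hρ.1 hφ.1 hφ.2.1)]
  simpa only [fderiv_apply_one_eq_deriv_add_inner hφ.1, Function.uncurry_apply_pair] using
    hρ.2 φ hφ

theorem IsWeakSolution.eqL1L1_of_osgood {n : ℕ} {T : ℝ} (hT : 0 < T)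
    {b : ℝ → EuclideanSpace ℝ (Fin n) → EuclideanSpace ℝ (Fin n)}
    (hb : AEStronglyMeasurable (Function.uncurry b) ((volume.restrict (Ioo 0 T)).prod volume))
    {w : ℝ → ℝ} (hw : MonotoneOn w (Ici 0)) (hwnn : ∀ s, 0 ≤ s → 0 ≤ w s) {r : ℝ} (hr : 0 < r)
    (hw0 : Tendsto (fun k : ℕ => w (r / 2 ^ k)) atTop (𝓝 0))
    (hwr : ∀ k : ℕ, 0 < w (r / 2 ^ k)) (hns : ¬ Summable fun k : ℕ => r / 2 ^ k / w (r / 2 ^ k))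
    {G : ℝ → ℝ} (hG : Continuous G) (hGm : MonotoneOn G (Ici 0)) (hG0 : ∀ s, 0 < G s)
    (hGtop : Tendsto (fun R => ∫ r in 0..R, (G r)⁻¹) atTop atTop)
    {C : ℝ} (hbG : ∀ᵐ t ∂(volume.restrict (Ioo 0 T)), ∀ x, ‖b t x‖ ≤ C * G ‖x‖)
    (hbw : ∀ᵐ t ∂(volume.restrict (Ioo 0 T)), ∀ x y, ‖b t x - b t y‖ ≤ w ‖x - y‖)
    {ρ₀ : EuclideanSpace ℝ (Fin n) → ℝ} {ρ₁ ρ₂ : ℝ → EuclideanSpace ℝ (Fin n) → ℝ}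
    (h₁ : IsWeakSolution T b ρ₀ ρ₁) (h₂ : IsWeakSolution T b ρ₀ ρ₂) : EqL1L1 T ρ₁ ρ₂ := by
  -- `A * G` dominates `C * G + w r`, because `G` is at least `G 0` on `[0, ∞)`.
  set A : ℝ := |C| + w r / G 0 with hA
  have hwr0 : 0 < w r := by simpa using hwr 0
  have hA0 : 0 < A := by have := hG0 0; positivity
  have hAG : ∀ s, 0 ≤ s → C * G s + w r ≤ A * G s := fun s hs => by
    have h1 : G 0 ≤ G s := hGm (mem_Ici.2 le_rfl) (mem_Ici.2 hs) hs
    have h2 : w r ≤ w r / G 0 * G s := by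
      rw [div_mul_eq_mul_div, le_div_iff₀ (hG0 0)]
      exact mul_le_mul_of_nonneg_left h1 hwr0.le
    have h3 : C * G s ≤ |C| * G s := mul_le_mul_of_nonneg_right (le_abs_self C) (hG0 s).le
    rw [hA, add_mul]
    linarith
  have hAm : MonotoneOn (fun s => A * G s) (Ici 0) := fun s hs s' hs' h =>
    mul_le_mul_of_nonneg_left (hGm hs hs' h) hA0.le
  have hbG' : ∀ᵐ t ∂(volume.restrict (Ioo 0 T)), ∀ x, ‖b t x‖ + w r ≤ A * G ‖x‖ := by
    filter_upwards [hbG] with t ht x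
    linarith [ht x, hAG ‖x‖ (norm_nonneg x)]
  have hbG'' : ∀ᵐ t ∂(volume.restrict (Ioo 0 T)), ∀ x, ‖b t x‖ ≤ A * G ‖x‖ := by
    filter_upwards [hbG'] with t ht x
    linarith [ht x]
  have hzero := ae_eq_zero_of_forall_integral_fderiv_eq_zero hT hb hw hwnn hr hw0 hwr hns
    (G := fun s => A * G s) (continuous_const.mul hG) hAm (fun s => mul_pos hA0 (hG0 s))
    (by
      rw [hA, add_mul, div_mul_cancel₀ _ (hG0 0).ne']
      linarith [mul_nonneg (abs_nonneg C) (hG0 0).le])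
    (by
      simp_rw [mul_inv, intervalIntegral.integral_const_mul]
      exact hGtop.const_mul_atTop (inv_pos.2 hA0))
    hbG' hbw (u := fun z => Function.uncurry ρ₁ z - Function.uncurry ρ₂ z) (h₁.1.sub h₂.1) (by
      intro φ hφC hφK hφs
      have hφ : IsTestFunction T φ := ⟨hφC, hφK, hφs⟩
      simp_rw [mul_sub]
      rw [integral_sub (integrable_fderiv_mul hb hAm hbG'' h₁.1 hφC hφK)
        (integrable_fderiv_mul hb hAm hbG'' h₂.1 hφC hφK)]
      linarith [h₁.integral_fderiv_mul hb hAm hbG'' hφ, h₂.integral_fderiv_mul hb hAm hbG'' hφ])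
  filter_upwards [Measure.ae_ae_of_ae_prod hzero] with t ht
  filter_upwards [ht] with x hx
  simpa [sub_eq_zero] using hx

theorem isWeakSolution_zero {n : ℕ} (T : ℝ)
    (b : ℝ → EuclideanSpace ℝ (Fin n) → EuclideanSpace ℝ (Fin n)) :
    IsWeakSolution T b 0 0 := by
  refine ⟨?_, fun φ _ => by simp⟩
  exact integrable_zero _ _ _

theorem IsGrowthBound.tendsto_integral_inv {G : ℝ → ℝ} (hG : IsGrowthBound G) :
    Tendsto (fun R => ∫ r in 0..R, (G (max r 0))⁻¹) atTop atTop := by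
  have hGc : Continuous fun r => G (max r 0) :=
    hG.continuousOn.comp_continuous (by fun_prop) fun r => mem_Ici.2 (le_max_right r 0)
  have hpos : ∀ r, 0 < G (max r 0) := fun r => hG.pos _ (le_max_right r 0)
  have hGi : Continuous fun r => (G (max r 0))⁻¹ := hGc.inv₀ fun r => (hpos r).ne'
  have hmono : Monotone fun R => ∫ r in 0..R, (G (max r 0))⁻¹ := by
    refine monotone_of_deriv_nonneg
      (fun s => (hGi.integral_hasStrictDerivAt 0 s).hasDerivAt.differentiableAt) fun s => ?_
    rw [(hGi.integral_hasStrictDerivAt 0 s).hasDerivAt.deriv]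
    exact (inv_pos.2 (hpos s)).le
  refine tendsto_atTop_atTop_of_monotone' hmono fun hbdd => ?_
  obtain ⟨A, hA⟩ := hbdd
  obtain ⟨r, hr, htop⟩ := hG.lintegral_eq_top
  have hint : IntegrableOn (fun r => (G (max r 0))⁻¹) (Ioi 0) := by
    refine integrableOn_Ioi_of_intervalIntegral_norm_bounded A 0 (b := fun R : ℝ => R)
      (fun R => (hGi.integrableOn_Icc).mono_set Ioc_subset_Icc_self) tendsto_id
      (Eventually.of_forall fun R => ?_)
    simp_rw [Real.norm_of_nonneg (inv_pos.2 (hpos _)).le]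
    exact hA ⟨R, rfl⟩
  have hfin := (hint.mono_set (Ioi_subset_Ioi hr.le)).lintegral_lt_top
  refine hfin.ne ?_
  rw [← htop]
  refine setLIntegral_congr_fun measurableSet_Ioi fun s hs => ?_
  have hs0 : 0 ≤ s := hr.le.trans (le_of_lt hs)
  simp only [max_eq_left hs0]
  rw [ENNReal.ofReal_inv_of_pos (hG.pos s hs0)]

/-- Otherwise `1 / w` would be bounded and its integral near `0` finite. -/
theorem IsOsgoodModulus.apply_zero {w : ℝ → ℝ} (hw : IsOsgoodModulus w) : w 0 = 0 := by
  by_contra hne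
  have hpos : 0 < w 0 := lt_of_le_of_ne (hw.nonneg 0 le_rfl) (Ne.symm hne)
  obtain ⟨r, hr, htop⟩ := hw.lintegral_eq_top
  have hle : ∫⁻ s in Ioc 0 r, (ENNReal.ofReal (w s))⁻¹
      ≤ ∫⁻ _ in Ioc 0 r, (ENNReal.ofReal (w 0))⁻¹ :=
    setLIntegral_mono measurable_const fun s hs =>
      ENNReal.inv_le_inv.2 (ENNReal.ofReal_le_ofReal
        (hw.monotoneOn (mem_Ici.2 le_rfl) (mem_Ici.2 hs.1.le) hs.1.le))
  rw [htop, setLIntegral_const, Real.volume_Ioc, top_le_iff] at hle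
  exact ENNReal.mul_ne_top (ENNReal.inv_ne_top.2 (by simpa using hpos)) ENNReal.ofReal_ne_top hle

/-- The added `r / 2 ^ k` keeps the denominators positive even if `w` vanishes. If the series
converged, its terms `e / (w e + e)` would eventually be below `1/2`, forcing `e < w e`. Then `e / w
e` is at most twice the term, and comparison on dyadic intervals makes `∫ ds / w` finite. -/
theorem IsOsgoodModulus.not_summable {w : ℝ → ℝ} (hw : IsOsgoodModulus w) :
    ∃ r, 0 < r ∧ ¬ Summable fun k : ℕ => r / 2 ^ k / (w (r / 2 ^ k) + r / 2 ^ k) := by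
  obtain ⟨r, hr, htop⟩ := hw.lintegral_eq_top
  refine ⟨r, hr, fun hs => ?_⟩
  set e : ℕ → ℝ := fun k => r / 2 ^ k with he
  have he0 : ∀ k, 0 < e k := fun k => by positivity
  have hesucc : ∀ k, e k - e (k + 1) = e (k + 1) := fun k => by
    simp only [he, pow_succ]; field_simp; ring
  have hsm : ∀ᶠ k in atTop, e k / (w (e k) + e k) < 1 / 2 :=
    hs.tendsto_atTop_zero.eventually (gt_mem_nhds (by norm_num))
  obtain ⟨K, hK⟩ := eventually_atTop.1 hsm
  have hwK : ∀ k, K ≤ k → e k < w (e k) := fun k hk => by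
    have h1 := hK k hk
    have h2 := hw.nonneg _ (he0 k).le
    rw [div_lt_iff₀ (by linarith [he0 k])] at h1
    linarith
  have hsum : Summable fun k => e (K + k + 1) / w (e (K + k + 1)) := by
    have h1 : Summable fun k => 2 * (e (k + (K + 1)) / (w (e (k + (K + 1))) + e (k + (K + 1)))) :=
      ((_root_.summable_nat_add_iff (K + 1)).2 hs).mul_left 2
    refine Summable.of_nonneg_of_le (fun k => div_nonneg (he0 _).le (hw.nonneg _ (he0 _).le))
      (fun k => ?_) h1
    have hk : K + k + 1 = k + (K + 1) := by ring
    rw [hk]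
    have h2 := hwK (k + (K + 1)) (by omega)
    have h3 := he0 (k + (K + 1))
    rw [mul_div_assoc', div_le_div_iff₀ (h3.trans h2) (by linarith)]
    nlinarith
  -- On a dyadic piece `1 / w` is largest at the lower end `e (K + k + 1)`, which is also the length
  -- of the piece.
  have hcover : Ioc 0 r ⊆ (⋃ k, Ioc (e (K + k + 1)) (e (K + k))) ∪ Ioc (e K) r := by
    intro s hs
    by_cases hsK : e K < s
    · exact Or.inr ⟨hsK, hs.2⟩
    · left
      push Not at hsK
      have hlim : Tendsto (fun k => e (K + k)) atTop (𝓝 0) := by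
        have h1 : Tendsto e atTop (𝓝 0) :=
          tendsto_const_nhds.div_atTop (tendsto_pow_atTop_atTop_of_one_lt one_lt_two)
        simpa only [add_comm] using (tendsto_add_atTop_iff_nat K).2 h1
      have hex : ∃ k, e (K + k) < s := (hlim.eventually (gt_mem_nhds hs.1)).exists
      classical
      have hfind := Nat.find_spec hex
      obtain ⟨j, hj⟩ := Nat.exists_eq_succ_of_ne_zero (n := Nat.find hex) (fun h0 => by
        rw [h0] at hfind; exact absurd hfind (not_lt.2 hsK))
      have hmin := Nat.find_min hex (m := j) (by omega)
      rw [hj] at hfind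
      exact mem_iUnion.2 ⟨j, hfind, not_lt.1 hmin⟩
  have hpiece : ∀ k, ∫⁻ s in Ioc (e (K + k + 1)) (e (K + k)), (ENNReal.ofReal (w s))⁻¹
      ≤ ENNReal.ofReal (e (K + k + 1) / w (e (K + k + 1))) := by
    intro k
    have hwp : 0 < w (e (K + k + 1)) := (he0 _).trans (hwK _ (by omega))
    calc _ ≤ ∫⁻ _ in Ioc (e (K + k + 1)) (e (K + k)), (ENNReal.ofReal (w (e (K + k + 1))))⁻¹ :=
          setLIntegral_mono measurable_const fun s hs =>
            ENNReal.inv_le_inv.2 (ENNReal.ofReal_le_ofReal (hw.monotoneOn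
              (mem_Ici.2 (he0 _).le) (mem_Ici.2 ((he0 _).trans hs.1).le) hs.1.le))
      _ = _ := by
          rw [setLIntegral_const, Real.volume_Ioc, hesucc, ENNReal.ofReal_div_of_pos hwp,
            mul_comm, div_eq_mul_inv]
  have hfin : ∫⁻ s in Ioc 0 r, (ENNReal.ofReal (w s))⁻¹ < ⊤ := by
    refine (lintegral_mono_set hcover).trans_lt ((lintegral_union_le _ _ _).trans_lt
      (ENNReal.add_lt_top.2 ⟨?_, ?_⟩))
    · refine (lintegral_iUnion_le _ _).trans_lt ((ENNReal.tsum_le_tsum hpiece).trans_lt ?_)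
      exact hsum.tsum_ofReal_lt_top
    · have hwp : 0 < w (e K) := (he0 _).trans (hwK _ le_rfl)
      have h1 : ∫⁻ s in Ioc (e K) r, (ENNReal.ofReal (w s))⁻¹
          ≤ ∫⁻ _ in Ioc (e K) r, (ENNReal.ofReal (w (e K)))⁻¹ :=
        setLIntegral_mono measurable_const fun s hs =>
          ENNReal.inv_le_inv.2 (ENNReal.ofReal_le_ofReal (hw.monotoneOn
            (mem_Ici.2 (he0 _).le) (mem_Ici.2 ((he0 _).trans hs.1).le) hs.1.le))
      refine h1.trans_lt ?_
      rw [setLIntegral_const, Real.volume_Ioc]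
      exact ENNReal.mul_lt_top (ENNReal.inv_lt_top.2 (by simpa using hwp)) ENNReal.ofReal_lt_top
  exact hfin.ne htop

theorem IsWeakSolution.eqL1L1_of_isOsgoodModulus {n : ℕ} {T : ℝ} (hT : 0 < T)
    {b : ℝ → EuclideanSpace ℝ (Fin n) → EuclideanSpace ℝ (Fin n)}
    (hb : AEStronglyMeasurable (Function.uncurry b) ((volume.restrict (Ioo 0 T)).prod volume))
    {G w : ℝ → ℝ} (hG : IsGrowthBound G) (hw : IsOsgoodModulus w) {C C' : ℝ}
    (hbG : ∀ᵐ t ∂(volume.restrict (Ioo 0 T)), ∀ x, ‖b t x‖ ≤ C * G ‖x‖)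
    (hbw : ∀ᵐ t ∂(volume.restrict (Ioo 0 T)), ∀ x y, ‖b t x - b t y‖ ≤ C' * w ‖x - y‖)
    {ρ₀ : EuclideanSpace ℝ (Fin n) → ℝ} {ρ₁ ρ₂ : ℝ → EuclideanSpace ℝ (Fin n) → ℝ}
    (h₁ : IsWeakSolution T b ρ₀ ρ₁) (h₂ : IsWeakSolution T b ρ₀ ρ₂) : EqL1L1 T ρ₁ ρ₂ := by
  obtain ⟨r, hr, hns⟩ := hw.not_summable
  set A : ℝ := |C'| + 1 with hA
  have hA0 : 0 < A := by positivity
  have hlim : Tendsto (fun k : ℕ => r / (2 : ℝ) ^ k) atTop (𝓝 0) :=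
    tendsto_const_nhds.div_atTop (tendsto_pow_atTop_atTop_of_one_lt one_lt_two)
  refine IsWeakSolution.eqL1L1_of_osgood hT hb (w := fun s => A * (w s + s))
    (G := fun s => G (max s 0)) (C := C) ?_ ?_ hr ?_ ?_ ?_ ?_ ?_ ?_ hG.tendsto_integral_inv ?_ ?_
    h₁ h₂
  · intro s hs s' hs' h
    exact mul_le_mul_of_nonneg_left (add_le_add (hw.monotoneOn hs hs' h) h) hA0.le
  · intro s hs
    exact mul_nonneg hA0.le (add_nonneg (hw.nonneg s hs) hs)
  · have h1 : Tendsto (fun k : ℕ => w (r / 2 ^ k)) atTop (𝓝 0) := by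
      have h2 := (hw.continuousOn 0 (mem_Ici.2 le_rfl)).tendsto
      rw [hw.apply_zero] at h2
      exact h2.comp (tendsto_nhdsWithin_iff.2
        ⟨hlim, Eventually.of_forall fun k => mem_Ici.2 (by positivity)⟩)
    simpa using (h1.add hlim).const_mul A
  · intro k
    have h1 : 0 < r / 2 ^ k := by positivity
    exact mul_pos hA0 (by linarith [hw.nonneg _ h1.le])
  · intro hs
    refine hns ((hs.mul_left A).congr fun k => ?_)
    have h1 : 0 < r / 2 ^ k := by positivity
    have h2 := hw.nonneg _ h1.le
    have h3 : w (r / 2 ^ k) + r / 2 ^ k ≠ 0 := by linarith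
    rw [← div_div, mul_comm, div_mul_eq_mul_div, div_mul_cancel₀ _ hA0.ne']
  · exact hG.continuousOn.comp_continuous (by fun_prop) fun r => mem_Ici.2 (le_max_right r 0)
  · intro s hs s' hs' h
    simp only [max_eq_left (mem_Ici.1 hs), max_eq_left (mem_Ici.1 hs')]
    exact hG.monotoneOn hs hs' h
  · exact fun s => hG.pos _ (le_max_right s 0)
  · simpa only [max_eq_left (norm_nonneg _)] using hbG
  · filter_upwards [hbw] with t ht x y
    refine (ht x y).trans ?_
    have h1 := hw.nonneg _ (norm_nonneg (x - y))
    have h2 := mul_le_mul_of_nonneg_right (le_abs_self C') h1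
    simp only [hA]
    nlinarith [norm_nonneg (x - y), abs_nonneg C', mul_nonneg (abs_nonneg C') (norm_nonneg (x - y))]

/-- For `0 < s ≤ t`, `e + 1/t` is the convex combination of `e + 1/s` and `e` with weights `s/t` and
`1 - s/t`; concavity of `log` and `log e ≥ 0` give the claim. -/
theorem monotoneOn_mul_log : MonotoneOn (fun s : ℝ => s * Real.log (Real.exp 1 + 1 / s)) (Ici 0) := by
  intro s hs t ht hst
  simp only [mem_Ici] at hs ht
  rcases hs.eq_or_lt with rfl | hs
  · simp only [zero_mul]
    refine mul_nonneg ht (Real.log_nonneg ?_)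
    have : 0 ≤ 1 / t := by positivity
    linarith [Real.add_one_le_exp 1]
  have ht0 : 0 < t := hs.trans_le hst
  have h0 : 0 ≤ s / t := by positivity
  have h2 : 0 ≤ 1 - s / t := by rw [sub_nonneg, div_le_one ht0]; exact hst
  have hpos : Real.exp 1 + 1 / s ∈ Ioi (0 : ℝ) := mem_Ioi.2 (by positivity)
  have hconc := strictConcaveOn_log_Ioi.concaveOn.2 hpos (mem_Ioi.2 (Real.exp_pos 1)) h0 h2
    (by ring)
  simp only [smul_eq_mul, Real.log_exp] at hconc
  have h1 : s / t * (Real.exp 1 + 1 / s) + (1 - s / t) * Real.exp 1 = Real.exp 1 + 1 / t := by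
    field_simp; ring
  rw [h1] at hconc
  have h3 : s / t * Real.log (Real.exp 1 + 1 / s) ≤ Real.log (Real.exp 1 + 1 / t) := by linarith
  rw [div_mul_eq_mul_div, div_le_iff₀ ht0] at h3
  simp only
  linarith

theorem log_exp_add_two_pow_le (k : ℕ) : Real.log (Real.exp 1 + 2 ^ k) ≤ k + 2 := by
  rw [Real.log_le_iff_le_exp (by positivity)]
  have h1 : (2 : ℝ) ≤ Real.exp 1 := by linarith [Real.add_one_le_exp 1]
  have h2 : (2 : ℝ) ^ k ≤ Real.exp 1 ^ k := pow_le_pow_left₀ (by norm_num) h1 k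
  have h3 : 1 ≤ Real.exp 1 ^ k := one_le_pow₀ (by linarith)
  have h4 : Real.exp (k + 2) = Real.exp 1 ^ k * (Real.exp 1 * Real.exp 1) := by
    rw [← Real.exp_nat_mul, ← Real.exp_add, ← Real.exp_add]; ring_nf
  rw [h4]
  generalize Real.exp 1 ^ k = X at h2 h3
  generalize Real.exp 1 = E at h1
  have h5 : E ≤ X * E := le_mul_of_one_le_left (by linarith) h3
  have h6 : X ≤ X * E := le_mul_of_one_le_right (by linarith) (by linarith)
  have h7 : X * E * 2 ≤ X * E * E := mul_le_mul_of_nonneg_left h1 (by linarith)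
  linarith

/-- The dyadic conditions are checked directly at `r = 1`: the modulus at `2⁻ᵏ` is at most a
multiple of `(k + 2) 2⁻ᵏ`, so it tends to zero while the Osgood series dominates a harmonic one. -/
theorem IsWeakSolution.eqL1L1_of_logLipschitz {n : ℕ} {T : ℝ} (hT : 0 < T)
    {b : ℝ → EuclideanSpace ℝ (Fin n) → EuclideanSpace ℝ (Fin n)}
    (hb : AEStronglyMeasurable (Function.uncurry b) ((volume.restrict (Ioo 0 T)).prod volume))
    {C : ℝ} (hbC : ∀ᵐ t ∂(volume.restrict (Ioo 0 T)),
        (∀ x, ‖b t x‖ ≤ C * (1 + ‖x‖)) ∧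
        (∀ x y, ‖b t x - b t y‖
          ≤ C * ‖x - y‖ * Real.log (Real.exp 1 + 1 / ‖x - y‖)))
    {ρ₀ : EuclideanSpace ℝ (Fin n) → ℝ} {ρ₁ ρ₂ : ℝ → EuclideanSpace ℝ (Fin n) → ℝ}
    (h₁ : IsWeakSolution T b ρ₀ ρ₁) (h₂ : IsWeakSolution T b ρ₀ ρ₂) : EqL1L1 T ρ₁ ρ₂ := by
  set A : ℝ := |C| + 1 with hA
  have hA0 : 0 < A := by positivity
  have hlog : ∀ s : ℝ, 0 ≤ s → 0 < Real.log (Real.exp 1 + 1 / s) := fun s hs => by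
    refine Real.log_pos ?_
    have : 0 ≤ 1 / s := by positivity
    linarith [Real.add_one_le_exp 1]
  have hpow : ∀ k : ℕ, Real.log (Real.exp 1 + 1 / (1 / 2 ^ k)) ≤ k + 2 := fun k => by
    rw [one_div_one_div]; exact log_exp_add_two_pow_le k
  refine IsWeakSolution.eqL1L1_of_osgood hT hb
    (w := fun s => A * (s * Real.log (Real.exp 1 + 1 / s))) (r := 1)
    (G := fun s => 1 + max s 0) (C := C) ?_ ?_ one_pos ?_ ?_ ?_ ?_ ?_ ?_ ?_ ?_ ?_
    h₁ h₂
  · intro s hs s' hs' h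
    exact mul_le_mul_of_nonneg_left (monotoneOn_mul_log hs hs' h) hA0.le
  · intro s hs
    have := hlog s hs
    positivity
  · have h1 : Tendsto (fun k : ℕ => A * ((k : ℝ) * (1 / 2) ^ k + 2 * (1 / 2) ^ k)) atTop (𝓝 0) := by
      simpa using ((tendsto_self_mul_const_pow_of_lt_one (r := (1 / 2 : ℝ)) (by norm_num)
        (by norm_num)).add ((tendsto_pow_atTop_nhds_zero_of_lt_one (r := (1 / 2 : ℝ)) (by norm_num)
          (by norm_num)).const_mul 2)).const_mul A
    refine squeeze_zero (fun k => ?_) (fun k => ?_) h1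
    · have := hlog (1 / 2 ^ k) (by positivity)
      positivity
    · rw [← add_mul, mul_comm ((k : ℝ) + 2), one_div_pow]
      have := hpow k
      gcongr
  · intro k
    have := hlog (1 / 2 ^ k) (by positivity)
    positivity
  · intro hs
    have h1 : Summable fun k : ℕ => 1 / ((k + 2 : ℕ) : ℝ) := by
      refine Summable.of_nonneg_of_le (fun k => by positivity) (fun k => ?_) (hs.mul_left A)
      have h2 := hlog (1 / 2 ^ k) (by positivity)
      have h3 : A * (1 / 2 ^ k / (A * (1 / 2 ^ k * Real.log (Real.exp 1 + 1 / (1 / 2 ^ k)))))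
          = 1 / Real.log (Real.exp 1 + 1 / (1 / 2 ^ k)) := by
        generalize Real.log (Real.exp 1 + 1 / (1 / 2 ^ k)) = l at h2
        field_simp
      rw [h3]
      refine one_div_le_one_div_of_le h2 ?_
      push_cast
      exact hpow k
    exact Real.not_summable_one_div_natCast ((_root_.summable_nat_add_iff 2).1 h1)
  · fun_prop
  · intro s hs s' hs' h
    simp only
    gcongr
  · intro s
    have := le_max_right s 0
    linarith
  · have h1 : Tendsto (fun R : ℝ => Real.log (1 + R)) atTop atTop :=
      Real.tendsto_log_atTop.comp (tendsto_atTop_add_const_left _ _ tendsto_id)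
    refine h1.congr' ?_
    filter_upwards [eventually_ge_atTop 0] with R hR
    have h2 : ∫ s in 0..R, (1 + max s 0)⁻¹ = ∫ s in 0..R, (1 + s)⁻¹ := by
      refine intervalIntegral.integral_congr fun s hs => ?_
      rw [uIcc_of_le hR] at hs
      simp only [max_eq_left hs.1]
    rw [h2, intervalIntegral.integral_comp_add_left (fun s => s⁻¹),
      integral_inv_of_pos (by norm_num) (by linarith)]
    simp
  · filter_upwards [hbC] with t ht x
    simpa only [max_eq_left (norm_nonneg x)] using ht.1 x
  · filter_upwards [hbC] with t ht x y
    refine (ht.2 x y).trans ?_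
    rw [mul_assoc]
    refine mul_le_mul_of_nonneg_right (by rw [hA]; linarith [le_abs_self C]) ?_
    exact mul_nonneg (norm_nonneg _) (hlog _ (norm_nonneg _)).le

end ContinuityEquation

end

theorem proposition1p2 (n : ℕ) (T : ℝ) (hT : 0 < T)
    (b : ℝ → EuclideanSpace ℝ (Fin n) → EuclideanSpace ℝ (Fin n))
    (hb : AEStronglyMeasurable (Function.uncurry b)
      ((volume.restrict (Ioo 0 T)).prod volume)) :
    -- linear growth and log-Lipschitz regularity
    (∀ C : ℝ,
      (∀ᵐ t ∂(volume.restrict (Ioo 0 T)),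
        (∀ x, ‖b t x‖ ≤ C * (1 + ‖x‖)) ∧
        (∀ x y, ‖b t x - b t y‖
          ≤ C * ‖x - y‖ * Real.log (Real.exp 1 + 1 / ‖x - y‖))) →
      ∀ ρ₀ : EuclideanSpace ℝ (Fin n) → ℝ, Integrable ρ₀ →
      ∀ ρ₁ ρ₂ : ℝ → EuclideanSpace ℝ (Fin n) → ℝ,
        ContinuityEquation.IsWeakSolution T b ρ₀ ρ₁ →
        ContinuityEquation.IsWeakSolution T b ρ₀ ρ₂ →
        ContinuityEquation.EqL1L1 T ρ₁ ρ₂)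
    ∧
    -- general growth bound and general global Osgood modulus
    (∀ G w : ℝ → ℝ,
      ContinuityEquation.IsGrowthBound G →
      ContinuityEquation.IsOsgoodModulus w →
      (∃ C : ℝ, ∀ᵐ t ∂(volume.restrict (Ioo 0 T)), ∀ x, ‖b t x‖ ≤ C * G ‖x‖) →
      (∃ C : ℝ, ∀ᵐ t ∂(volume.restrict (Ioo 0 T)), ∀ x y,
        ‖b t x - b t y‖ ≤ C * w ‖x - y‖) →
      (∀ u : ℝ → EuclideanSpace ℝ (Fin n) → ℝ,
        ContinuityEquation.IsWeakSolution T b 0 u →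
        ContinuityEquation.EqL1L1 T u 0) ∧
      (∀ ρ₀ : EuclideanSpace ℝ (Fin n) → ℝ, Integrable ρ₀ →
        ∀ ρ₁ ρ₂ : ℝ → EuclideanSpace ℝ (Fin n) → ℝ,
          ContinuityEquation.IsWeakSolution T b ρ₀ ρ₁ →
          ContinuityEquation.IsWeakSolution T b ρ₀ ρ₂ →
          ContinuityEquation.EqL1L1 T ρ₁ ρ₂)) := by
  refine ⟨fun C hC ρ₀ _ ρ₁ ρ₂ h₁ h₂ => h₁.eqL1L1_of_logLipschitz hT hb hC h₂, ?_⟩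
  rintro G w hG hw ⟨C, hC⟩ ⟨C', hC'⟩
  exact ⟨fun u hu => hu.eqL1L1_of_isOsgoodModulus hT hb hG hw hC hC'
      (ContinuityEquation.isWeakSolution_zero T b),
    fun ρ₀ _ ρ₁ ρ₂ h₁ h₂ => h₁.eqL1L1_of_isOsgoodModulus hT hb hG hw hC hC' h₂⟩
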